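/- Gamma degradation model. Let $\alpha>0$, $\gamma\in\mathbb R$, $\beta=\alpha e^{-\gamma}$, $\theta=(\alpha,\gamma)$. Let $Z$ be a gamma process with independent increments whose increment over an interval of length $t$ is $\mathrm{Gam}(\alpha t,\beta)$ (shape, rate). A design $\zeta=(n,m,\tau)$ with integers $n,m\ge 1$ and $\tau>0$ observes $n$ independent copies of $Z$ at the times $\tau,2\tau,\dots,m\tau$. Let $l(\theta)$ be the log-likelihood of the $nm$ increments and $\mathbf I(\theta;\zeta)=E_\theta\left(-\partial^2 l/\partial\theta\,\partial\theta^{T}\right)$ the Fisher information matrix. Let $\eta>0$, $0<p<1$. For the lifetime $Q=\inf\{t: Z_t\ge\eta\}$, with distribution function $F_Q(t;\theta)=P(Z_t\ge\eta)$, let $\xi_p=F_Q^{-1}(p;\theta)$ be the $p$-th quantile and $\mathbf h=(h_1,h_2)^T=\partial \xi_p/\partial\theta$. Put $$\phi_V(\zeta)=\mathbf h^{T}\,\mathbf I(\theta;\zeta)^{-1}\mathbf h,\qquad \phi_A(\zeta)=\operatorname{tr}\left(\mathbf I(\theta;\zeta)^{-1}\right).$$ Let $\psi_r(x)=\frac{d^{r+1}}{dx^{r+1}}\log\Gamma(x)$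 and $$\Omega(x)=\frac{2x\psi_1(x)+x^2\psi_2(x)-1}{(x\psi_1(x)-1)^2},\qquad x>0.$$ **Theorem.** Let $n,m\ge1$ be fixed and let $\Delta t>0$ be the minimal admissible inspection interval. The function $\Omega$ is a bijection from $(0,\infty)$ onto $(-2/3,0)$; let $\Omega^{-1}$ be its inverse. (V-optimality) Suppose $h_1\neq0$. If $\dfrac{h_2^2}{\alpha^2h_1^2}\ge\dfrac23$, then $\phi_V$ is strictly decreasing in $\tau\in(0,\infty)$. Otherwise $-\dfrac{h_2^2}{\alpha^2h_1^2}\in(-2/3,0)$, and $\phi_V$ on $\tau\in[\Delta t,\infty)$ attains its minimum at exactly one point, namely $$\tau=\max\left\{\Delta t,\ \frac1\alpha\,\Omega^{-1}\left(-\frac{h_2^2}{\alpha^2h_1^2}\right)\right\}.$$ (A-optimality) The same holds for $\phi_A$ with $h_1^2=h_2^2$: if $1/\alpha^2\ge 2/3$, then $\phi_A$ is strictly decreasing in $\tau\in(0,\infty)$; otherwise $\phi_A$ on $[\Delta t,\infty)$ has the unique minimizer $\tau=\max\{\Delta t,\ \Omega^{-1}(-1/\alpha^2)/\alpha\}$.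 -/

import Mathlib

open MeasureTheory ProbabilityTheory Set

namespace GammaDegradation

noncomputable section

/-! ### The gamma degradation model

The parameter is `θ = (α, γ)` with `α > 0` and `γ = log (α / β)`, so the rate is
`β = α * exp (-γ)`. -/

/-- Law of an increment of the gamma process over a time interval of length `t`:
the gamma distribution with shape `α * t` and rate `β = α * exp (-γ)`. -/
def incrementLaw (α γ t : ℝ) : Measure ℝ :=
  gammaMeasure (α * t) (α * Real.exp (-γ))

/-- Joint law of the increments `ΔZ i j` of `n` independent units observed at `m` inspections
with inspection intervals `dt j`; all the increments are mutually independent. -/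
def dataLaw (n m : ℕ) (dt : Fin m → ℝ) (α γ : ℝ) : Measure (Fin n × Fin m → ℝ) :=
  Measure.pi fun ij => incrementLaw α γ (dt ij.2)

/-- Log-likelihood of the parameter `(α, γ)` given the increments `z`. -/
def logLikelihood {n m : ℕ} (dt : Fin m → ℝ) (z : Fin n × Fin m → ℝ) (α γ : ℝ) : ℝ :=
  ∑ i : Fin n, ∑ j : Fin m,
    Real.log (gammaPDFReal (α * dt j) (α * Real.exp (-γ)) (z (i, j)))

/-- Partial derivative with respect to `α`. -/
def partialAlpha (f : ℝ → ℝ → ℝ) (α γ : ℝ) : ℝ := deriv (fun a => f a γ) α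

/-- Partial derivative with respect to `γ`. -/
def partialGamma (f : ℝ → ℝ → ℝ) (α γ : ℝ) : ℝ := deriv (fun g => f α g) γ

/-- Fisher information matrix `E (- ∂² l / ∂θ ∂θᵀ)`, where the expectation is under the law of the
data with the same parameter. -/
def fisherInfo (n m : ℕ) (dt : Fin m → ℝ) (α γ : ℝ) : Matrix (Fin 2) (Fin 2) ℝ :=
  !![∫ z, -partialAlpha (partialAlpha (logLikelihood dt z)) α γ ∂dataLaw n m dt α γ,
     ∫ z, -partialAlpha (partialGamma (logLikelihood dt z)) α γ ∂dataLaw n m dt α γ;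
     ∫ z, -partialGamma (partialAlpha (logLikelihood dt z)) α γ ∂dataLaw n m dt α γ,
     ∫ z, -partialGamma (partialGamma (logLikelihood dt z)) α γ ∂dataLaw n m dt α γ]

/-! ### Lifetime quantile -/

/-- Distribution function of the lifetime (first passage time of the threshold `η`): the paths of
the gamma process are nondecreasing, so `F_Q t = P (Z t ≥ η)` for `t > 0`. -/
def lifetimeCDF (η α γ t : ℝ) : ℝ := (incrementLaw α γ t).real (Ici η)

/-- The `p`-th quantile `ξ_p` of the lifetime. -/
def lifetimeQuantile (η p α γ : ℝ) : ℝ := sInf {t : ℝ | 0 < t ∧ p ≤ lifetimeCDF η α γ t}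

/-- First component `h₁ = ∂ ξ_p / ∂ α` of the gradient of the quantile. -/
def h₁ (η p α γ : ℝ) : ℝ := partialAlpha (lifetimeQuantile η p) α γ

/-- Second component `h₂ = ∂ ξ_p / ∂ γ` of the gradient of the quantile. -/
def h₂ (η p α γ : ℝ) : ℝ := partialGamma (lifetimeQuantile η p) α γ

/-! ### The design criteria for periodic inspections -/

/-- V-optimality criterion `hᵀ I(θ; ζ)⁻¹ h` of the design with `n` units and `m` inspections at
equal intervals `τ`, i.e. the asymptotic variance of the estimated quantile. -/
def phiV (η p α γ : ℝ) (n m : ℕ) (τ : ℝ) : ℝ :=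
  ![h₁ η p α γ, h₂ η p α γ] ⬝ᵥ
    (Matrix.mulVec (fisherInfo n m (fun _ => τ) α γ)⁻¹ ![h₁ η p α γ, h₂ η p α γ])

/-- A-optimality criterion `tr I(θ; ζ)⁻¹` of the same design. -/
def phiA (α γ : ℝ) (n m : ℕ) (τ : ℝ) : ℝ :=
  Matrix.trace (fisherInfo n m (fun _ => τ) α γ)⁻¹

/-! ### The function `Ω` -/

/-- Polygamma function `ψ_r`, the derivative of order `r + 1` of `log Γ`. -/
def polygamma (r : ℕ) (x : ℝ) : ℝ := iteratedDeriv (r + 1) (fun y => Real.log (Real.Gamma y)) x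

/-- `Ω x = (2 x ψ₁(x) + x² ψ₂(x) - 1) / (x ψ₁(x) - 1)²`, used for `x > 0`. -/
def Omega (x : ℝ) : ℝ :=
  (2 * x * polygamma 1 x + x ^ 2 * polygamma 2 x - 1) / (x * polygamma 1 x - 1) ^ 2

/-- The inverse of `Ω` on `(0, ∞)`. -/
def OmegaInv (y : ℝ) : ℝ := Function.invFunOn Omega (Ioi 0) y

/-- `τ₀` is the unique minimizer of `φ` over the set `S`. -/
def IsUniqueMinimizerOn (φ : ℝ → ℝ) (S : Set ℝ) (τ₀ : ℝ) : Prop :=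
  τ₀ ∈ S ∧ ∀ τ ∈ S, τ ≠ τ₀ → φ τ₀ < φ τ

end

end GammaDegradation

namespace GammaDegradation

open Filter Topology
open scoped Pointwise

/-! Since `γ` is the logarithm of the mean rate, `α` and `γ` are orthogonal parameters. With `P x =
x² ψ₁ x - x` (`trigammaExcess`), the information matrix is `n m` times the diagonal matrix with
entries `P (α τ) / α²` and `α τ` (`fisherInfo_eq`). Both criteria are therefore positive multiples
of `k / x + 1 / P x` at `x = α τ`, with `k = h₂² / (α² h₁²)` or `k = 1 / α²`. Put `N = x² P'`
(`trigammaExcessSlope`). Then `Ω = N / P²`, and the derivative of the criterion is `-(k + Ω x) /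
x²`, so everything rests on `Ω` decreasing strictly from `0` to `-2/3`.

The crux is that `N` decreases. Its derivative is `6 x²` times the difference between `∑ k² / (x +
k)⁴` and the corresponding integral `1 / (3 x)`. A Laplace transform turns the claim that the sum is
smaller into a pointwise inequality of integrands, which is Lazarević's inequality `x³ cosh x <
sinh³ x` (`tsum_sq_div_pow_four_lt`). As `N` starts from `0`, it is negative, so `P` decreases from
`1` to `1/2`. Thus `-Ω` is an increasing positive function over a decreasing one, and `N → -1/6`
gives the limit `-2/3`.

An interior minimizer in the V-case also needs `k > 0`, that is `h₂ ≠ 0`. The quantile is `α⁻¹ S (α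
e^{-γ} η)` for a function `S` of one variable, so `h₂` is a nonzero multiple of `S'`; a zero of `S'`
is excluded by `not_hasDerivAt_scaledQuantile_zero`. -/

/-! ### Series for log Γ and the polygamma functions -/

/-- The Hurwitz zeta series `∑ₖ 1 / (x + k) ^ j`. -/
noncomputable def hurwitzSum (j : ℕ) (x : ℝ) : ℝ := ∑' k : ℕ, 1 / (x + k) ^ j

lemma summable_hurwitzSum {j : ℕ} (hj : 2 ≤ j) {x : ℝ} (hx : 0 < x) :
    Summable fun k : ℕ => 1 / (x + k) ^ j := by
  have h := (Real.summable_one_div_nat_add_rpow x j).2 (by exact_mod_cast hj)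
  refine h.congr fun k => ?_
  rw [abs_of_pos (by positivity), Real.rpow_natCast, add_comm]

lemma hasSum_hurwitzSum {j : ℕ} (hj : 2 ≤ j) {x : ℝ} (hx : 0 < x) :
    HasSum (fun k : ℕ => 1 / (x + k) ^ j) (hurwitzSum j x) :=
  (summable_hurwitzSum hj hx).hasSum

lemma hurwitzSum_eq_add {j : ℕ} (hj : 2 ≤ j) {x : ℝ} (hx : 0 < x) :
    hurwitzSum j x = 1 / x ^ j + hurwitzSum j (x + 1) := by
  rw [hurwitzSum, (summable_hurwitzSum hj hx).tsum_eq_zero_add, hurwitzSum]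
  simp only [Nat.cast_zero, add_zero, Nat.cast_add, Nat.cast_one]
  congr 2
  ext k
  ring_nf

lemma hasDerivAt_hurwitzSum {j : ℕ} (hj : 2 ≤ j) {x : ℝ} (hx : 0 < x) :
    HasDerivAt (hurwitzSum j) (-j * hurwitzSum (j + 1) x) x := by
  have hx2 : 0 < x / 2 := by positivity
  -- On `(x / 2, ∞)` the differentiated terms are dominated by their values at `x / 2`.
  have key := hasDerivAt_tsum_of_isPreconnected (t := Ioi (x / 2)) (y₀ := x) (y := x)
    (u := fun k : ℕ => (j : ℝ) * (1 / (x / 2 + k) ^ (j + 1)))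
    (g := fun (k : ℕ) (y : ℝ) => 1 / (y + k) ^ j)
    (g' := fun (k : ℕ) (y : ℝ) => -(j : ℝ) * (1 / (y + k) ^ (j + 1)))
    ((summable_hurwitzSum (by omega) hx2).mul_left _) isOpen_Ioi (convex_Ioi _).isPreconnected
    ?_ ?_ (by simp; linarith) (summable_hurwitzSum hj hx) (by simp; linarith)
  · rwa [tsum_mul_left] at key
  · intro k y hy
    have hy0 : 0 < y + k := by
      have : 0 < y := hx2.trans hy
      positivity
    have h1 : HasDerivAt (fun y : ℝ => (y + k) ^ j) (j * (y + k) ^ (j - 1) * 1) y :=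
      ((hasDerivAt_id y).add_const (k : ℝ)).pow j
    have h2 := h1.inv (by positivity)
    simp only [one_div]
    refine h2.congr_deriv ?_
    obtain ⟨i, rfl⟩ : ∃ i, j = i + 1 := ⟨j - 1, by omega⟩
    simp only [Nat.add_sub_cancel]
    field_simp
    ring
  · intro k y hy
    have hy' : x / 2 < y := hy
    have : 0 < y := by linarith
    rw [norm_mul, norm_neg, Real.norm_natCast, Real.norm_of_nonneg (by positivity)]
    gcongr

/-- The general term of the series for `log Γ x + log x`. -/
noncomputable def logGammaTerm (k : ℕ) (x : ℝ) : ℝ :=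
  x * Real.log ((k + 2) / (k + 1)) - Real.log ((x + (k + 1)) / (k + 1))

/-- The general term of the series for the digamma function. -/
noncomputable def digammaTerm (k : ℕ) (x : ℝ) : ℝ :=
  Real.log ((k + 2) / (k + 1)) - 1 / (x + (k + 1))

lemma hasDerivAt_logGammaTerm (k : ℕ) {x : ℝ} (hx : 0 < x) :
    HasDerivAt (logGammaTerm k) (digammaTerm k x) x := by
  have h1 : HasDerivAt (fun y : ℝ => (y + (k + 1)) / (k + 1)) (1 / (k + 1)) x :=
    ((hasDerivAt_id x).add_const _).div_const _
  have h2 := h1.log (by positivity)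
  have h3 := (hasDerivAt_mul_const (x := x) (Real.log ((k + 2 : ℝ) / (k + 1)))).sub h2
  refine h3.congr_deriv ?_
  rw [digammaTerm]
  field_simp

/-- The logarithm lies between `1 / (k + 2)` and `1 / (k + 1)`, and each of these is close enough to
`1 / (x + k + 1)`. The bound is uniform on `(0, b]`, as termwise differentiation requires. -/
lemma abs_digammaTerm_le (k : ℕ) {x b : ℝ} (hx : 0 < x) (hb : 1 ≤ b) (hxb : x ≤ b) :
    |digammaTerm k x| ≤ b * (1 / (1 + k) ^ 2) := by
  have hk : (0 : ℝ) < k + 1 := by positivity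
  have hup : Real.log ((k + 2 : ℝ) / (k + 1)) ≤ 1 / (k + 1) := by
    refine (Real.log_le_sub_one_of_pos (by positivity)).trans_eq ?_
    field_simp; ring
  have hlow : 1 / (k + 2 : ℝ) ≤ Real.log ((k + 2 : ℝ) / (k + 1)) := by
    refine le_trans (le_of_eq ?_) (Real.one_sub_inv_le_log_of_pos (by positivity))
    field_simp; ring
  have h1 : 1 / (k + 1 : ℝ) - 1 / (x + (k + 1)) ≤ b * (1 / (1 + k) ^ 2) := by
    rw [div_sub_div _ _ (by positivity) (by positivity), mul_one_div,
      div_le_div_iff₀ (by positivity) (by positivity)]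
    have : x * (1 + k : ℝ) ^ 2 ≤ b * ((k + 1) * (x + (k + 1))) := by
      calc x * (1 + k : ℝ) ^ 2 ≤ b * (1 + k) ^ 2 := by gcongr
        _ = b * ((k + 1) * (0 + (k + 1))) := by ring
        _ ≤ _ := by gcongr
    nlinarith
  have h2 : 1 / (x + (k + 1)) - 1 / (k + 2 : ℝ) ≤ b * (1 / (1 + k) ^ 2) := by
    rw [div_sub_div _ _ (by positivity) (by positivity), mul_one_div,
      div_le_div_iff₀ (by positivity) (by positivity)]
    have : 1 * (1 + k : ℝ) ^ 2 ≤ b * ((x + (k + 1)) * (k + 2)) := by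
      calc 1 * (1 + k : ℝ) ^ 2 ≤ b * (1 + k) ^ 2 := by gcongr
        _ = b * ((0 + (k + 1)) * (k + 1)) := by ring
        _ ≤ _ := by gcongr; norm_num
    nlinarith [mul_nonneg hx.le (sq_nonneg (1 + k : ℝ))]
  rw [digammaTerm, abs_le]
  constructor <;> linarith

lemma summable_logGammaTerm_and_hasDerivAt {x : ℝ} (hx : 0 < x) :
    Summable (fun k => logGammaTerm k x) ∧
      HasDerivAt (fun y => ∑' k, logGammaTerm k y) (∑' k, digammaTerm k x) x := by
  set b := x + 1
  have hu : Summable fun k : ℕ => b * (1 / (1 + k : ℝ) ^ 2) :=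
    (summable_hurwitzSum le_rfl one_pos).mul_left _
  have hg : ∀ (k : ℕ) (y : ℝ), y ∈ Ioo 0 b → HasDerivAt (logGammaTerm k) (digammaTerm k y) y :=
    fun k y hy => hasDerivAt_logGammaTerm k hy.1
  have hg' : ∀ (k : ℕ) (y : ℝ), y ∈ Ioo 0 b → ‖digammaTerm k y‖ ≤ b * (1 / (1 + k : ℝ) ^ 2) :=
    fun k y hy => abs_digammaTerm_le k hy.1 (by linarith) hy.2.le
  -- The base point is `1` because every term of the series vanishes there.
  have h1 : (1 : ℝ) ∈ Ioo 0 b := ⟨one_pos, by linarith⟩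
  have h0 : Summable fun k => logGammaTerm k 1 := by
    convert summable_zero with k
    rw [logGammaTerm, one_mul, sub_eq_zero]
    ring_nf
  have hxm : x ∈ Ioo 0 b := ⟨hx, by linarith⟩
  exact ⟨summable_of_summable_hasDerivAt_of_isPreconnected hu isOpen_Ioo
    (convex_Ioo _ _).isPreconnected hg hg' h1 h0 hxm,
    hasDerivAt_tsum_of_isPreconnected hu isOpen_Ioo
    (convex_Ioo _ _).isPreconnected hg hg' h1 h0 hxm⟩

/-- The first logarithms telescope to `x log (n + 1)`, while Euler's sequence has `x log n`; the
last summand is this discrepancy, which tends to zero. -/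
lemma sum_logGammaTerm (n : ℕ) {x : ℝ} (hx : 0 < x) :
    ∑ k ∈ Finset.range n, logGammaTerm k x =
      Real.BohrMollerup.logGammaSeq x n + Real.log x
        + x * (Real.log (n + 1 : ℝ) - Real.log n) := by
  induction n with
  | zero => simp [Real.BohrMollerup.logGammaSeq]
  | succ n ih =>
    rw [Finset.sum_range_succ, ih]
    simp only [Real.BohrMollerup.logGammaSeq, Finset.sum_range_succ _ (n + 1), logGammaTerm,
      Nat.factorial_succ]
    have hn : (0 : ℝ) < n + 1 := by positivity
    have hf : (0 : ℝ) < n.factorial := by exact_mod_cast Nat.factorial_pos n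
    push_cast
    rw [Real.log_div (by positivity) hn.ne', Real.log_div (by positivity) hn.ne',
      Real.log_mul hn.ne' hf.ne', show (n + 1 + 1 : ℝ) = n + 2 by ring]
    ring

lemma log_Gamma_eq_tsum {x : ℝ} (hx : 0 < x) :
    Real.log (Real.Gamma x) = -Real.log x + ∑' k, logGammaTerm k x := by
  have h1 := (summable_logGammaTerm_and_hasDerivAt hx).1.hasSum.tendsto_sum_nat
  have h2 : Tendsto (fun n : ℕ => Real.log (n + 1 : ℝ) - Real.log n) atTop (𝓝 0) :=
    Real.tendsto_log_nat_add_one_sub_log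
  have h3 := ((Real.BohrMollerup.tendsto_log_gamma hx).add_const (Real.log x)).add
    (h2.const_mul x)
  have h4 := tendsto_nhds_unique h1 (h3.congr fun n => (sum_logGammaTerm n hx).symm)
  linarith

/-- The digamma function as a series. -/
noncomputable def digammaSeries (x : ℝ) : ℝ := -1 / x + ∑' k, digammaTerm k x

lemma hasDerivAt_log_Gamma {x : ℝ} (hx : 0 < x) :
    HasDerivAt (fun y => Real.log (Real.Gamma y)) (digammaSeries x) x := by
  have h1 := (Real.hasDerivAt_log hx.ne').neg.add (summable_logGammaTerm_and_hasDerivAt hx).2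
  have h2 : (-x⁻¹ + ∑' k, digammaTerm k x) = digammaSeries x := by
    rw [digammaSeries, neg_div, one_div]
  rw [h2] at h1
  refine h1.congr_of_eventuallyEq ?_
  filter_upwards [Ioi_mem_nhds hx] with y hy
  exact log_Gamma_eq_tsum hy

lemma hasDerivAt_digammaSeries {x : ℝ} (hx : 0 < x) :
    HasDerivAt digammaSeries (hurwitzSum 2 x) x := by
  set b := x + 1
  have hsum (y : ℝ) (hy : 0 < y) : Summable fun k => digammaTerm k y :=
    Summable.of_norm_bounded (g := fun k : ℕ => (y + 1) * (1 / (1 + k : ℝ) ^ 2))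
      ((summable_hurwitzSum le_rfl one_pos).mul_left _)
      fun k => abs_digammaTerm_le k hy (by linarith) (by linarith)
  have key := hasDerivAt_tsum_of_isPreconnected (t := Ioi 0) (y₀ := x) (y := x)
    (u := fun k : ℕ => 1 / (1 + k : ℝ) ^ 2)
    (g := digammaTerm) (g' := fun k y => 1 / (y + 1 + k) ^ 2)
    (summable_hurwitzSum le_rfl one_pos) isOpen_Ioi (convex_Ioi _).isPreconnected
    ?_ ?_ hx (hsum x hx) hx
  · have h1 : HasDerivAt (fun y : ℝ => -1 / y) (1 / x ^ 2) x := by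
      have := (hasDerivAt_inv hx.ne').neg
      simp only [neg_neg] at this
      simpa [neg_div, one_div, Pi.neg_def] using this
    have h2 := h1.add key
    rw [hurwitzSum_eq_add le_rfl hx]
    exact h2
  · intro k y hy
    have hy0 : (0 : ℝ) < y := hy
    have h1 : HasDerivAt (fun y : ℝ => y + (k + 1)) 1 y := (hasDerivAt_id y).add_const _
    have h2 := (h1.inv (by positivity)).const_sub (Real.log ((k + 2 : ℝ) / (k + 1)))
    convert h2 using 1
    · ext z; simp [digammaTerm]
    · field_simp; ring
  · intro k y hy
    have hy0 : (0 : ℝ) < y := hy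
    rw [Real.norm_of_nonneg (by positivity)]
    gcongr
    linarith

lemma deriv_deriv_log_Gamma {x : ℝ} (hx : 0 < x) :
    deriv (deriv fun y => Real.log (Real.Gamma y)) x = hurwitzSum 2 x := by
  refine ((hasDerivAt_digammaSeries hx).congr_of_eventuallyEq ?_).deriv
  filter_upwards [Ioi_mem_nhds hx] with y hy using (hasDerivAt_log_Gamma hy).deriv

lemma polygamma_one {x : ℝ} (hx : 0 < x) : polygamma 1 x = hurwitzSum 2 x := by
  rw [polygamma, iteratedDeriv_succ, iteratedDeriv_one]
  exact deriv_deriv_log_Gamma hx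

lemma polygamma_two {x : ℝ} (hx : 0 < x) : polygamma 2 x = -2 * hurwitzSum 3 x := by
  rw [polygamma, iteratedDeriv_succ, iteratedDeriv_succ, iteratedDeriv_one]
  refine ((hasDerivAt_hurwitzSum le_rfl hx).congr_of_eventuallyEq ?_).deriv.trans (by norm_num)
  filter_upwards [Ioi_mem_nhds hx] with y hy using deriv_deriv_log_Gamma hy

/-! ### Lazarević's inequality and the comparison of sum and integral -/

lemma pos_of_hasDerivAt_pos {f f' : ℝ → ℝ} (h0 : f 0 = 0) (hf : ∀ x, HasDerivAt f (f' x) x)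
    (hf' : ∀ x, 0 < x → 0 < f' x) {x : ℝ} (hx : 0 < x) : 0 < f x := by
  have h : StrictMonoOn f (Ici 0) := by
    refine strictMonoOn_of_deriv_pos (convex_Ici 0)
      (fun y _ => (hf y).continuousAt.continuousWithinAt) fun y hy => ?_
    rw [interior_Ici] at hy
    rw [(hf y).deriv]
    exact hf' y hy
  simpa [h0] using h self_mem_Ici hx.le hx

lemma one_add_sq_div_two_lt_cosh {x : ℝ} (hx : 0 < x) : 1 + x ^ 2 / 2 < Real.cosh x := by
  have := pos_of_hasDerivAt_pos (f := fun x => Real.cosh x - (1 + x ^ 2 / 2))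
    (f' := fun x => Real.sinh x - x) (by simp) (fun x => ?_)
    (fun x hx => sub_pos.2 (Real.self_lt_sinh_iff.2 hx)) hx
  · linarith
  · exact ((Real.hasDerivAt_cosh x).sub
      (((hasDerivAt_pow 2 x).div_const 2).const_add 1)).congr_deriv (by norm_num)

lemma add_cube_div_six_lt_sinh {x : ℝ} (hx : 0 < x) : x + x ^ 3 / 6 < Real.sinh x := by
  have := pos_of_hasDerivAt_pos (f := fun x => Real.sinh x - (x + x ^ 3 / 6))
    (f' := fun x => Real.cosh x - (1 + x ^ 2 / 2)) (by simp) (fun x => ?_)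
    (fun x hx => sub_pos.2 (one_add_sq_div_two_lt_cosh hx)) hx
  · linarith
  · exact ((Real.hasDerivAt_sinh x).sub
      ((hasDerivAt_id x).add ((hasDerivAt_pow 3 x).div_const 6))).congr_deriv (by norm_num; ring)

lemma sinh_lt_mul_cosh {x : ℝ} (hx : 0 < x) : Real.sinh x < x * Real.cosh x := by
  have := pos_of_hasDerivAt_pos (f := fun x => x * Real.cosh x - Real.sinh x)
    (f' := fun x => x * Real.sinh x) (by simp) (fun x => ?_)
    (fun x hx => mul_pos hx (Real.sinh_pos_iff.2 hx)) hx
  · linarith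
  · exact (((hasDerivAt_id x).mul (Real.hasDerivAt_cosh x)).sub
      (Real.hasDerivAt_sinh x)).congr_deriv (by simp)

/-- Lazarević's inequality. -/
lemma cube_mul_cosh_lt_sinh_cube {x : ℝ} (hx : 0 < x) :
    x ^ 3 * Real.cosh x < Real.sinh x ^ 3 := by
  have := pos_of_hasDerivAt_pos (f := fun x => Real.sinh x ^ 3 - x ^ 3 * Real.cosh x)
    (f' := fun x => 3 * Real.cosh x * (Real.sinh x ^ 2 - x ^ 2) - x ^ 3 * Real.sinh x)
    (by simp) (fun x => ?_) (fun x hx => ?_) hx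
  · linarith
  · exact (((Real.hasDerivAt_sinh x).pow 3).sub
      ((hasDerivAt_pow 3 x).mul (Real.hasDerivAt_cosh x))).congr_deriv (by norm_num; ring)
  -- Squaring the Taylor bound gives `sinh² x - x² ≥ x⁴ / 3`, so the derivative is at least `x³ (x
  -- cosh x - sinh x)`, which is positive.
  · have h1 := add_cube_div_six_lt_sinh hx
    have h2 := sinh_lt_mul_cosh hx
    have hc := Real.cosh_pos x
    have h3 : x ^ 4 / 3 ≤ Real.sinh x ^ 2 - x ^ 2 := by
      have : (x + x ^ 3 / 6) ^ 2 ≤ Real.sinh x ^ 2 := by gcongr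
      nlinarith [sq_nonneg (x ^ 3)]
    have h4 : 3 * Real.cosh x * (x ^ 4 / 3) ≤ 3 * Real.cosh x * (Real.sinh x ^ 2 - x ^ 2) := by
      gcongr
    have h5 : x ^ 3 * Real.sinh x < x ^ 3 * (x * Real.cosh x) := by gcongr
    nlinarith

/-- This is Lazarević's inequality at `t / 2`, multiplied by `16 e^{-3t/2}`. -/
lemma cube_mul_exp_lt {t : ℝ} (ht : 0 < t) :
    t ^ 3 * (Real.exp (-t) * (1 + Real.exp (-t))) < 2 * (1 - Real.exp (-t)) ^ 3 := by
  have h := cube_mul_cosh_lt_sinh_cube (half_pos ht)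
  set e := Real.exp (-(t / 2)) with he
  have he0 : 0 < e := Real.exp_pos _
  have h1 : Real.exp (-t) = e ^ 2 := by rw [he, ← Real.exp_nat_mul]; ring_nf
  have h2 : Real.exp (t / 2) = e⁻¹ := by rw [he, Real.exp_neg, inv_inv]
  rw [Real.cosh_eq, Real.sinh_eq, ← he, h2] at h
  rw [h1]
  have h3 := mul_lt_mul_of_pos_left h (show 0 < 16 * e ^ 3 by positivity)
  have e1 : 16 * e ^ 3 * ((t / 2) ^ 3 * ((e⁻¹ + e) / 2)) = t ^ 3 * (e ^ 2 * (1 + e ^ 2)) := by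
    field_simp; ring
  have e2 : 16 * e ^ 3 * ((e⁻¹ - e) / 2) ^ 3 = 2 * (1 - e ^ 2) ^ 3 := by
    field_simp; ring
  linarith

lemma hasSum_sq_mul_geometric {q : ℝ} (hq0 : 0 ≤ q) (hq : q < 1) :
    HasSum (fun k : ℕ => (k : ℝ) ^ 2 * q ^ k) (q * (1 + q) / (1 - q) ^ 3) := by
  have hn : ‖q‖ < 1 := by rwa [Real.norm_of_nonneg hq0]
  -- Uses `k² = 2 C(k+2, 2) - 3 C(k+1, 1) + C(k, 0)`.
  have h := (((hasSum_choose_mul_geometric_of_norm_lt_one 2 hn).mul_left 2).sub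
    ((hasSum_choose_mul_geometric_of_norm_lt_one 1 hn).mul_left 3)).add
    (hasSum_choose_mul_geometric_of_norm_lt_one 0 hn)
  have h1 : 0 < 1 - q := by linarith
  convert! h using 1
  · ext k
    rw [Nat.cast_choose_two]
    simp
    ring
  · field_simp
    ring

lemma integral_cube_mul_exp {r : ℝ} (hr : 0 < r) :
    ∫ t in Ioi (0 : ℝ), t ^ 3 * Real.exp (-(r * t)) = 6 / r ^ 4 := by
  have h := Real.integral_rpow_mul_exp_neg_mul_Ioi (a := 4) (by norm_num) hr
  have h4 : Real.Gamma 4 = 6 := by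
    rw [show (4 : ℝ) = (3 : ℕ) + 1 by norm_num, Real.Gamma_nat_eq_factorial]
    norm_num [Nat.factorial]
  rw [h4] at h
  norm_num at h
  norm_cast at h
  rw [h]
  field_simp

/-- A function that is not integrable has Bochner integral `0`, whereas this integral was computed
to be positive. -/
lemma integrableOn_cube_mul_exp {r : ℝ} (hr : 0 < r) :
    IntegrableOn (fun t => t ^ 3 * Real.exp (-(r * t))) (Ioi (0 : ℝ)) := by
  by_contra h
  have h2 := integral_cube_mul_exp hr
  rw [integral_undef h] at h2
  exact absurd h2 (by positivity)

lemma summable_sq_div_pow_four {x : ℝ} (hx : 0 < x) :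
    Summable fun k : ℕ => (k : ℝ) ^ 2 / (x + k) ^ 4 := by
  refine Summable.of_nonneg_of_le (fun k => by positivity) (fun k => ?_)
    (summable_hurwitzSum le_rfl hx)
  rw [div_le_div_iff₀ (by positivity) (by positivity), one_mul]
  have : (k : ℝ) ^ 2 ≤ (x + k) ^ 2 := by gcongr; linarith
  calc (k : ℝ) ^ 2 * (x + k) ^ 2 ≤ (x + k) ^ 2 * (x + k) ^ 2 := by gcongr
    _ = _ := by ring

/-- The sum of `k ^ 2 / (x + k) ^ 4` is less than the integral over `k ∈ (0, ∞)`. -/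
lemma tsum_sq_div_pow_four_lt {x : ℝ} (hx : 0 < x) :
    ∑' k : ℕ, (k : ℝ) ^ 2 / (x + k) ^ 4 < 1 / (3 * x) := by
  -- Since `6 / (x + k)⁴` is the Laplace transform of `t³` at `x + k`, the sum over `k` becomes a
  -- geometric-type series under the integral.
  let F : ℕ → ℝ → ℝ := fun k t => (k : ℝ) ^ 2 / 6 * (t ^ 3 * Real.exp (-((x + k) * t)))
  have hF (k : ℕ) : ∫ t in Ioi (0 : ℝ), F k t = (k : ℝ) ^ 2 / (x + k) ^ 4 := by
    rw [integral_const_mul, integral_cube_mul_exp (by positivity)]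
    field_simp
  have hFi (k : ℕ) : IntegrableOn (F k) (Ioi 0) :=
    (integrableOn_cube_mul_exp (by positivity)).const_mul _
  have hFn (k : ℕ) : ∫ t in Ioi (0 : ℝ), ‖F k t‖ = (k : ℝ) ^ 2 / (x + k) ^ 4 := by
    rw [← hF k]
    refine setIntegral_congr_fun measurableSet_Ioi fun t ht => ?_
    have : (0 : ℝ) < t := ht
    exact Real.norm_of_nonneg (by positivity)
  have hs := hasSum_integral_of_summable_integral_norm hFi
    ((summable_sq_div_pow_four hx).congr fun k => (hFn k).symm)
  simp_rw [hF] at hs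
  rw [hs.tsum_eq]
  let G : ℝ → ℝ := fun t => t ^ 3 / 6 * Real.exp (-(x * t)) *
    (Real.exp (-t) * (1 + Real.exp (-t)) / (1 - Real.exp (-t)) ^ 3)
  have hG (t : ℝ) (ht : 0 < t) : ∑' k, F k t = G t := by
    have h := (hasSum_sq_mul_geometric (Real.exp_pos (-t)).le
      (Real.exp_lt_one_iff.2 (by linarith : -t < 0))).mul_left (t ^ 3 / 6 * Real.exp (-(x * t)))
    refine HasSum.tsum_eq ?_
    convert! h using 1
    ext k
    simp only [F]
    rw [← Real.exp_nat_mul, show -((x + k) * t) = -(x * t) + k * (-t) by ring, Real.exp_add]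
    ring
  rw [setIntegral_congr_fun measurableSet_Ioi hG]
  have hlt (t : ℝ) (ht : 0 < t) : G t < 1 / 3 * Real.exp (-x * t) := by
    have h1 : 0 < 1 - Real.exp (-t) := sub_pos.2 (Real.exp_lt_one_iff.2 (by linarith))
    have h2 : t ^ 3 * (Real.exp (-t) * (1 + Real.exp (-t))) / (1 - Real.exp (-t)) ^ 3 < 2 := by
      rw [div_lt_iff₀ (by positivity)]
      exact cube_mul_exp_lt ht
    have h3 : G t = 1 / 6 * Real.exp (-x * t) *
        (t ^ 3 * (Real.exp (-t) * (1 + Real.exp (-t))) / (1 - Real.exp (-t)) ^ 3) := by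
      simp only [G, neg_mul]; ring
    have h4 := mul_lt_mul_of_pos_left h2 (show 0 < 1 / 6 * Real.exp (-x * t) by positivity)
    rw [h3]
    linarith
  have hG0 (t : ℝ) (ht : 0 < t) : 0 ≤ G t := by
    have h1 : 0 < 1 - Real.exp (-t) := sub_pos.2 (Real.exp_lt_one_iff.2 (by linarith))
    positivity
  have hE : IntegrableOn (fun t => 1 / 3 * Real.exp (-x * t)) (Ioi (0 : ℝ)) :=
    (integrableOn_exp_mul_Ioi (by linarith) 0).const_mul _
  have hGi : IntegrableOn G (Ioi 0) := by
    refine Integrable.mono' hE (by fun_prop) ?_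
    filter_upwards [ae_restrict_mem measurableSet_Ioi] with t ht
    rw [Real.norm_of_nonneg (hG0 t ht)]
    exact (hlt t ht).le
  have hEv : ∫ t in Ioi (0 : ℝ), 1 / 3 * Real.exp (-x * t) = 1 / (3 * x) := by
    rw [integral_const_mul, integral_exp_mul_Ioi (by linarith)]
    simp
    ring
  -- Strictness survives integration: the difference of the integrands is positive on all of `(0,
  -- ∞)`, a set of positive measure.
  rw [← hEv, ← sub_pos, ← integral_sub hE hGi,
    setIntegral_pos_iff_support_of_nonneg_ae ?_ (hE.sub' hGi)]
  · refine lt_of_lt_of_le (b := volume (Ioi (0 : ℝ))) (by simp) (measure_mono fun t ht => ?_)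
    exact ⟨(sub_pos.2 (hlt t ht)).ne', ht⟩
  · filter_upwards [ae_restrict_mem measurableSet_Ioi] with t ht
    exact (sub_pos.2 (hlt t ht)).le

/-! ### Bounds for the series by telescoping -/

section Telescoping

variable {f a : ℝ → ℝ}

lemma tendsto_sum_telescope (hlim : Tendsto f atTop (𝓝 0)) (x : ℝ) :
    Tendsto (fun n : ℕ => ∑ k ∈ Finset.range n, (f (x + k) - f (x + k + 1))) atTop (𝓝 (f x)) := by
  have h (n : ℕ) : ∑ k ∈ Finset.range n, (f (x + k) - f (x + k + 1)) = f x - f (x + n) := by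
    induction n with
    | zero => simp
    | succ n ih =>
      rw [Finset.sum_range_succ, ih]
      push_cast
      rw [← add_assoc]
      ring
  simp_rw [h]
  simpa using (hlim.comp (tendsto_const_nhds.add_atTop tendsto_natCast_atTop_atTop)).const_sub (f x)

lemma tsum_le_of_telescope (hlim : Tendsto f atTop (𝓝 0))
    (h : ∀ y, 0 < y → a y ≤ f y - f (y + 1)) {x s : ℝ} (hx : 0 < x)
    (hs : HasSum (fun k : ℕ => a (x + k)) s) : s ≤ f x :=
  le_of_tendsto_of_tendsto' hs.tendsto_sum_nat (tendsto_sum_telescope hlim x)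
    fun _ => Finset.sum_le_sum fun k _ => h (x + k) (by positivity)

lemma le_tsum_of_telescope (hlim : Tendsto f atTop (𝓝 0))
    (h : ∀ y, 0 < y → f y - f (y + 1) ≤ a y) {x s : ℝ} (hx : 0 < x)
    (hs : HasSum (fun k : ℕ => a (x + k)) s) : f x ≤ s :=
  le_of_tendsto_of_tendsto' (tendsto_sum_telescope hlim x) hs.tendsto_sum_nat
    fun _ => Finset.sum_le_sum fun k _ => h (x + k) (by positivity)

end Telescoping

lemma tendsto_const_div_pow_atTop (c : ℝ) {k : ℕ} (hk : k ≠ 0) :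
    Tendsto (fun x : ℝ => c / x ^ k) atTop (𝓝 0) :=
  tendsto_const_nhds.div_atTop (tendsto_pow_atTop hk)

/-- The comparison function is a truncation of the asymptotic expansion of `ψ₁`; its
backward-looking decrement `f y - f (y + 1)` exceeds `1 / y²` by an explicit positive fraction. The
next three bounds use further truncations, for `ψ₁` and `-ψ₂ / 2`, in the same way. -/
lemma hurwitzSum_two_le {x : ℝ} (hx : 0 < x) :
    hurwitzSum 2 x ≤ 1 / x ^ 1 + (1 / 2) / x ^ 2 + (1 / 6) / x ^ 3 := by
  refine tsum_le_of_telescope (f := fun x => 1 / x ^ 1 + (1 / 2) / x ^ 2 + (1 / 6) / x ^ 3)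
    (a := fun y => 1 / y ^ 2) ?_ (fun y hy => ?_) hx (hasSum_hurwitzSum le_rfl hx)
  · simpa using ((tendsto_const_div_pow_atTop 1 one_ne_zero).add
      (tendsto_const_div_pow_atTop (1 / 2) two_ne_zero)).add
      (tendsto_const_div_pow_atTop (1 / 6) three_ne_zero)
  · rw [← sub_nonneg]
    have : 0 ≤ 1 / (6 * y ^ 3 * (y + 1) ^ 3) := by positivity
    refine this.trans_eq ?_
    field_simp
    ring

lemma le_hurwitzSum_two {x : ℝ} (hx : 0 < x) :
    1 / x ^ 1 + (1 / 2) / x ^ 2 + (1 / 6) / x ^ 3 - (1 / 30) / x ^ 5 ≤ hurwitzSum 2 x := by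
  refine le_tsum_of_telescope
    (f := fun x => 1 / x ^ 1 + (1 / 2) / x ^ 2 + (1 / 6) / x ^ 3 - (1 / 30) / x ^ 5)
    (a := fun y => 1 / y ^ 2) ?_ (fun y hy => ?_) hx (hasSum_hurwitzSum le_rfl hx)
  · simpa using (((tendsto_const_div_pow_atTop 1 one_ne_zero).add
      (tendsto_const_div_pow_atTop (1 / 2) two_ne_zero)).add
      (tendsto_const_div_pow_atTop (1 / 6) three_ne_zero)).sub
      (tendsto_const_div_pow_atTop (1 / 30) (k := 5) (by norm_num))
  · rw [← sub_nonneg]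
    have : 0 ≤ (5 * y ^ 2 + 5 * y + 1) / (30 * y ^ 5 * (y + 1) ^ 5) := by positivity
    refine this.trans_eq ?_
    field_simp
    ring

lemma hurwitzSum_three_le {x : ℝ} (hx : 0 < x) :
    hurwitzSum 3 x ≤ (1 / 2) / x ^ 2 + (1 / 2) / x ^ 3 + (1 / 4) / x ^ 4 := by
  refine tsum_le_of_telescope
    (f := fun x => (1 / 2) / x ^ 2 + (1 / 2) / x ^ 3 + (1 / 4) / x ^ 4)
    (a := fun y => 1 / y ^ 3) ?_ (fun y hy => ?_) hx (hasSum_hurwitzSum (by norm_num) hx)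
  · simpa using ((tendsto_const_div_pow_atTop (1 / 2) two_ne_zero).add
      (tendsto_const_div_pow_atTop (1 / 2) three_ne_zero)).add
      (tendsto_const_div_pow_atTop (1 / 4) four_ne_zero)
  · rw [← sub_nonneg]
    have : 0 ≤ (2 * y + 1) / (4 * y ^ 4 * (y + 1) ^ 4) := by positivity
    refine this.trans_eq ?_
    field_simp
    ring

lemma le_hurwitzSum_three {x : ℝ} (hx : 0 < x) :
    (1 / 2) / x ^ 2 + (1 / 2) / x ^ 3 + (1 / 4) / x ^ 4 - (1 / 12) / x ^ 6 ≤ hurwitzSum 3 x := by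
  refine le_tsum_of_telescope
    (f := fun x => (1 / 2) / x ^ 2 + (1 / 2) / x ^ 3 + (1 / 4) / x ^ 4 - (1 / 12) / x ^ 6)
    (a := fun y => 1 / y ^ 3) ?_ (fun y hy => ?_) hx (hasSum_hurwitzSum (by norm_num) hx)
  · simpa using (((tendsto_const_div_pow_atTop (1 / 2) two_ne_zero).add
      (tendsto_const_div_pow_atTop (1 / 2) three_ne_zero)).add
      (tendsto_const_div_pow_atTop (1 / 4) four_ne_zero)).sub
      (tendsto_const_div_pow_atTop (1 / 12) (k := 6) (by norm_num))
  · rw [← sub_nonneg]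
    have : 0 ≤ (8 * y ^ 3 + 12 * y ^ 2 + 6 * y + 1) / (12 * y ^ 6 * (y + 1) ^ 6) := by positivity
    refine this.trans_eq ?_
    field_simp
    ring

/-! ### Monotonicity and range of Ω -/

/-- `x ^ 2 * ψ₁ x - x`. -/
noncomputable def trigammaExcess (x : ℝ) : ℝ := x ^ 2 * hurwitzSum 2 x - x

/-- `x ^ 2` times the derivative of `trigammaExcess`. -/
noncomputable def trigammaExcessSlope (x : ℝ) : ℝ :=
  2 * x ^ 3 * hurwitzSum 2 x - 2 * x ^ 4 * hurwitzSum 3 x - x ^ 2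

lemma hasDerivAt_trigammaExcess {x : ℝ} (hx : 0 < x) :
    HasDerivAt trigammaExcess (trigammaExcessSlope x / x ^ 2) x := by
  have h := ((hasDerivAt_pow 2 x).mul (hasDerivAt_hurwitzSum (j := 2) le_rfl hx)).sub
    (hasDerivAt_id x)
  refine h.congr_deriv ?_
  rw [trigammaExcessSlope]
  norm_num
  field_simp
  ring

/-- The weight `x²` in front of `P'` makes the bracket a sum of squares minus `1 / (3 x)`. -/
lemma hasDerivAt_trigammaExcessSlope {x : ℝ} (hx : 0 < x) :
    HasDerivAt trigammaExcessSlope (6 * x ^ 2 *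
      (hurwitzSum 2 x - 2 * x * hurwitzSum 3 x + x ^ 2 * hurwitzSum 4 x - 1 / (3 * x))) x := by
  have h := ((((hasDerivAt_pow 3 x).const_mul 2).mul
    (hasDerivAt_hurwitzSum (j := 2) le_rfl hx)).sub
    (((hasDerivAt_pow 4 x).const_mul 2).mul
      (hasDerivAt_hurwitzSum (j := 3) (by norm_num) hx))).sub (hasDerivAt_pow 2 x)
  refine h.congr_deriv ?_
  norm_num
  field_simp
  ring

/-- Writing `k = (x + k) - x` in `k² / (x + k)⁴` and expanding the square gives the left-hand side.
-/
lemma hurwitzSum_combination_lt {x : ℝ} (hx : 0 < x) :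
    hurwitzSum 2 x - 2 * x * hurwitzSum 3 x + x ^ 2 * hurwitzSum 4 x < 1 / (3 * x) := by
  refine lt_of_eq_of_lt ?_ (tsum_sq_div_pow_four_lt hx)
  refine (HasSum.tsum_eq ?_).symm
  convert! ((hasSum_hurwitzSum le_rfl hx).sub
    ((hasSum_hurwitzSum (j := 3) (by norm_num) hx).mul_left (2 * x))).add
    ((hasSum_hurwitzSum (j := 4) (by norm_num) hx).mul_left (x ^ 2)) using 1
  ext k
  have : x + k ≠ 0 := by positivity
  field_simp
  ring

lemma strictAntiOn_Ioi_of_hasDerivAt_neg {f f' : ℝ → ℝ}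
    (hf : ∀ x, 0 < x → HasDerivAt f (f' x) x) (hf' : ∀ x, 0 < x → f' x < 0) :
    StrictAntiOn f (Ioi 0) := by
  refine strictAntiOn_of_deriv_neg (convex_Ioi 0)
    (fun y hy => (hf y hy).continuousAt.continuousWithinAt) fun y hy => ?_
  rw [interior_Ioi] at hy
  rw [(hf y hy).deriv]
  exact hf' y hy

lemma strictAntiOn_trigammaExcessSlope : StrictAntiOn trigammaExcessSlope (Ioi 0) :=
  strictAntiOn_Ioi_of_hasDerivAt_neg (fun _ => hasDerivAt_trigammaExcessSlope) fun x hx =>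
    mul_neg_of_pos_of_neg (by positivity) (sub_neg.2 (hurwitzSum_combination_lt hx))

/-- Once the singular term `1 / x ^ j` is split off, the remaining series is continuous at `0`. -/
lemma tendsto_hurwitzSum_add_one {j : ℕ} (hj : 2 ≤ j) :
    Tendsto (fun x => hurwitzSum j (x + 1)) (𝓝[>] 0) (𝓝 (hurwitzSum j 1)) := by
  have h : ContinuousAt (hurwitzSum j) (0 + 1) := by
    rw [zero_add]
    exact (hasDerivAt_hurwitzSum hj one_pos).continuousAt
  have h2 : ContinuousAt (fun x : ℝ => hurwitzSum j (x + 1)) 0 :=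
    ContinuousAt.comp (f := fun x : ℝ => x + 1) h (by fun_prop)
  simpa using h2.tendsto.mono_left (nhdsWithin_le_nhds (s := Ioi 0))

lemma tendsto_pow_nhdsGT_zero {k : ℕ} (hk : k ≠ 0) :
    Tendsto (fun x : ℝ => x ^ k) (𝓝[>] 0) (𝓝 0) := by
  have h : Tendsto (fun x : ℝ => x ^ k) (𝓝 0) (𝓝 (0 ^ k)) := (continuous_pow k).tendsto 0
  rw [zero_pow hk] at h
  exact h.mono_left nhdsWithin_le_nhds

lemma tendsto_trigammaExcess_nhdsGT_zero : Tendsto trigammaExcess (𝓝[>] 0) (𝓝 1) := by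
  have h := (((tendsto_pow_nhdsGT_zero two_ne_zero).mul (tendsto_hurwitzSum_add_one le_rfl)).sub
    (tendsto_pow_nhdsGT_zero one_ne_zero)).const_add 1
  rw [zero_mul, sub_zero, add_zero] at h
  refine h.congr' ?_
  filter_upwards [self_mem_nhdsWithin] with x hx
  have hx0 : (0 : ℝ) < x := hx
  rw [trigammaExcess, hurwitzSum_eq_add le_rfl hx0]
  field_simp
  ring

lemma tendsto_trigammaExcessSlope_nhdsGT_zero : Tendsto trigammaExcessSlope (𝓝[>] 0) (𝓝 0) := by
  have h := ((((tendsto_pow_nhdsGT_zero three_ne_zero).mul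
    (tendsto_hurwitzSum_add_one le_rfl)).const_mul 2).sub
    (((tendsto_pow_nhdsGT_zero four_ne_zero).mul
    (tendsto_hurwitzSum_add_one (j := 3) (by norm_num))).const_mul 2)).sub
    (tendsto_pow_nhdsGT_zero two_ne_zero)
  simp only [zero_mul, mul_zero, sub_zero] at h
  refine h.congr' ?_
  filter_upwards [self_mem_nhdsWithin] with x hx
  have hx0 : (0 : ℝ) < x := hx
  rw [trigammaExcessSlope, hurwitzSum_eq_add le_rfl hx0, hurwitzSum_eq_add (by norm_num) hx0]
  field_simp
  ring

lemma tendsto_trigammaExcess_atTop : Tendsto trigammaExcess atTop (𝓝 (1 / 2)) := by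
  have h1 := (tendsto_const_div_pow_atTop (1 / 6) one_ne_zero).const_add (1 / 2 : ℝ)
  have h2 := h1.sub (tendsto_const_div_pow_atTop (1 / 30) three_ne_zero)
  simp only [add_zero, sub_zero] at h1 h2
  refine tendsto_of_tendsto_of_tendsto_of_le_of_le' h2 h1 ?_ ?_
  · filter_upwards [eventually_gt_atTop 0] with x hx
    have := mul_le_mul_of_nonneg_left (le_hurwitzSum_two hx) (sq_nonneg x)
    refine le_trans (le_of_eq ?_) (sub_le_sub_right this x)
    field_simp
    ring
  · filter_upwards [eventually_gt_atTop 0] with x hx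
    have := mul_le_mul_of_nonneg_left (hurwitzSum_two_le hx) (sq_nonneg x)
    refine le_trans (sub_le_sub_right this x) (le_of_eq ?_)
    field_simp
    ring

/-- The terms of order `x²` and `x` cancel, and the constant is `2/6 - 2/4 = -1/6`. -/
lemma tendsto_trigammaExcessSlope_atTop :
    Tendsto trigammaExcessSlope atTop (𝓝 (-1 / 6)) := by
  have h1 := (tendsto_const_div_pow_atTop (1 / 6) two_ne_zero).const_add (-1 / 6 : ℝ)
  have h2 := (tendsto_const_div_pow_atTop (1 / 15) two_ne_zero).const_sub (-1 / 6 : ℝ)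
  simp only [add_zero, sub_zero] at h1 h2
  refine tendsto_of_tendsto_of_tendsto_of_le_of_le' h2 h1 ?_ ?_
  · filter_upwards [eventually_gt_atTop 0] with x hx
    have e1 := mul_le_mul_of_nonneg_left (le_hurwitzSum_two hx) (show 0 ≤ 2 * x ^ 3 by positivity)
    have e2 := mul_le_mul_of_nonneg_left (hurwitzSum_three_le hx)
      (show 0 ≤ 2 * x ^ 4 by positivity)
    refine le_trans (le_of_eq ?_) (sub_le_sub_right (sub_le_sub e1 e2) (x ^ 2))
    field_simp
    ring
  · filter_upwards [eventually_gt_atTop 0] with x hx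
    have e1 := mul_le_mul_of_nonneg_left (hurwitzSum_two_le hx) (show 0 ≤ 2 * x ^ 3 by positivity)
    have e2 := mul_le_mul_of_nonneg_left (le_hurwitzSum_three hx)
      (show 0 ≤ 2 * x ^ 4 by positivity)
    refine le_trans (sub_le_sub_right (sub_le_sub e1 e2) (x ^ 2)) (le_of_eq ?_)
    field_simp
    ring

lemma StrictAntiOn.lt_of_tendsto_nhdsGT {f : ℝ → ℝ} {b : ℝ} (hf : StrictAntiOn f (Ioi 0))
    (hb : Tendsto f (𝓝[>] 0) (𝓝 b)) {x : ℝ} (hx : 0 < x) : f x < b := by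
  have hx2 : 0 < x / 2 := half_pos hx
  refine (hf (mem_Ioi.2 hx2) (mem_Ioi.2 hx) (half_lt_self hx)).trans_le (ge_of_tendsto hb ?_)
  filter_upwards [Ioo_mem_nhdsGT hx2] with y hy
  exact (hf hy.1 (mem_Ioi.2 hx2) hy.2).le

lemma StrictAntiOn.gt_of_tendsto_atTop {f : ℝ → ℝ} {a : ℝ} (hf : StrictAntiOn f (Ioi 0))
    (ha : Tendsto f atTop (𝓝 a)) {x : ℝ} (hx : 0 < x) : a < f x := by
  have hx1 : x < x + 1 := by linarith
  refine lt_of_le_of_lt (le_of_tendsto ha ?_) (hf (mem_Ioi.2 hx) (mem_Ioi.2 (hx.trans hx1)) hx1)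
  filter_upwards [eventually_gt_atTop (x + 1)] with y hy
  exact (hf (mem_Ioi.2 (hx.trans hx1)) (mem_Ioi.2 (by linarith)) hy).le

lemma StrictAntiOn.bijOn_Ioo {f : ℝ → ℝ} {a b : ℝ} (hf : StrictAntiOn f (Ioi 0))
    (hc : ContinuousOn f (Ioi 0)) (hb : Tendsto f (𝓝[>] 0) (𝓝 b)) (ha : Tendsto f atTop (𝓝 a)) :
    BijOn f (Ioi 0) (Ioo a b) := by
  refine ⟨fun x hx => ⟨StrictAntiOn.gt_of_tendsto_atTop hf ha hx,
    StrictAntiOn.lt_of_tendsto_nhdsGT hf hb hx⟩, hf.injOn, fun y hy => ?_⟩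
  obtain ⟨u, hu, hu0⟩ := ((hb.eventually_const_lt hy.2).and self_mem_nhdsWithin).exists
  obtain ⟨v, hv, hv0⟩ := ((ha.eventually_lt_const hy.1).and (eventually_gt_atTop 0)).exists
  exact isPreconnected_Ioi.intermediate_value (mem_Ioi.2 hv0) hu0 hc ⟨hv.le, hu.le⟩

lemma trigammaExcessSlope_neg {x : ℝ} (hx : 0 < x) : trigammaExcessSlope x < 0 :=
  StrictAntiOn.lt_of_tendsto_nhdsGT strictAntiOn_trigammaExcessSlope
    tendsto_trigammaExcessSlope_nhdsGT_zero hx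

lemma strictAntiOn_trigammaExcess : StrictAntiOn trigammaExcess (Ioi 0) :=
  strictAntiOn_Ioi_of_hasDerivAt_neg (fun _ => hasDerivAt_trigammaExcess) fun _ hx =>
    div_neg_of_neg_of_pos (trigammaExcessSlope_neg hx) (by positivity)

lemma trigammaExcess_pos {x : ℝ} (hx : 0 < x) : 0 < trigammaExcess x :=
  one_half_pos.trans (StrictAntiOn.gt_of_tendsto_atTop strictAntiOn_trigammaExcess
    tendsto_trigammaExcess_atTop hx)

lemma Omega_eq {x : ℝ} (hx : 0 < x) :
    Omega x = trigammaExcessSlope x / trigammaExcess x ^ 2 := by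
  have hP := trigammaExcess_pos hx
  have h1 : trigammaExcess x = x * (x * hurwitzSum 2 x - 1) := by rw [trigammaExcess]; ring
  have h2 : x * hurwitzSum 2 x - 1 ≠ 0 := by
    rintro h
    rw [h1, h, mul_zero] at hP
    exact hP.false
  rw [Omega, polygamma_one hx, polygamma_two hx, h1, trigammaExcessSlope]
  field_simp
  ring

lemma strictAntiOn_Omega : StrictAntiOn Omega (Ioi 0) := by
  intro x hx y hy hxy
  have hy0 := trigammaExcess_pos hy
  rw [Omega_eq hx, Omega_eq hy]
  have hN := strictAntiOn_trigammaExcessSlope hx hy hxy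
  have hP := strictAntiOn_trigammaExcess hx hy hxy
  have h := div_lt_div₀' (neg_le_neg hN.le) (pow_lt_pow_left₀ hP hy0.le two_ne_zero)
    (neg_pos.2 (trigammaExcessSlope_neg hy)) (by positivity)
  rw [neg_div, neg_div] at h
  linarith

lemma continuousOn_Omega : ContinuousOn Omega (Ioi 0) := by
  refine ContinuousOn.congr (f := fun x => trigammaExcessSlope x / trigammaExcess x ^ 2) ?_
    fun x hx => Omega_eq hx
  intro x hx
  exact ((hasDerivAt_trigammaExcessSlope hx).continuousAt.div
    ((hasDerivAt_trigammaExcess hx).continuousAt.pow 2)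
    (pow_ne_zero 2 (trigammaExcess_pos hx).ne')).continuousWithinAt

/-- `Ω` is a bijection from `(0, ∞)` onto `(-2/3, 0)`. -/
lemma bijOn_Omega : BijOn Omega (Ioi 0) (Ioo (-2 / 3) 0) := by
  refine StrictAntiOn.bijOn_Ioo strictAntiOn_Omega continuousOn_Omega ?_ ?_
  · have h := tendsto_trigammaExcessSlope_nhdsGT_zero.div
      (tendsto_trigammaExcess_nhdsGT_zero.pow 2) (by norm_num)
    rw [zero_div] at h
    refine h.congr' ?_
    filter_upwards [self_mem_nhdsWithin] with x hx using (Omega_eq hx).symm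
  · have h := tendsto_trigammaExcessSlope_atTop.div
      (tendsto_trigammaExcess_atTop.pow 2) (by norm_num)
    rw [show (-1 / 6 : ℝ) / (1 / 2) ^ 2 = -2 / 3 by norm_num] at h
    refine h.congr' ?_
    filter_upwards [eventually_gt_atTop 0] with x hx using (Omega_eq hx).symm

/-! ### Fisher information of a periodic design -/

lemma measurable_gammaPDF (a r : ℝ) : Measurable (gammaPDF a r) :=
  (measurable_gammaPDFReal a r).ennreal_ofReal

lemma integral_id_gammaMeasure {a r : ℝ} (ha : 0 < a) (hr : 0 < r) :
    ∫ x, x ∂gammaMeasure a r = a / r := by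
  have h1 : ∫ x, x ∂gammaMeasure a r = ∫ x, gammaPDFReal a r x * x := by
    rw [gammaMeasure, integral_withDensity_eq_integral_toReal_smul
      (measurable_gammaPDF a r) (ae_of_all _ fun _ => ENNReal.ofReal_lt_top)]
    simp only [gammaPDF, smul_eq_mul, ENNReal.toReal_ofReal (gammaPDFReal_nonneg ha hr _)]
  have h2 : ∫ x, gammaPDFReal a r x * x = ∫ x in Ioi 0, gammaPDFReal a r x * x := by
    refine (setIntegral_eq_integral_of_forall_compl_eq_zero fun x hx => ?_).symm
    rcases (notMem_Ioi.1 hx).lt_or_eq with h | h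
    · simp [gammaPDFReal, not_le.2 h]
    · simp [h]
  have h3 : ∫ x in Ioi 0, gammaPDFReal a r x * x =
      ∫ x in Ioi 0, r ^ a / Real.Gamma a * (x ^ (a + 1 - 1) * Real.exp (-(r * x))) := by
    refine setIntegral_congr_fun measurableSet_Ioi fun x hx => ?_
    have hx0 : (0 : ℝ) < x := hx
    simp only [gammaPDFReal, if_pos hx0.le]
    rw [show a + 1 - 1 = a - 1 + 1 by ring, Real.rpow_add_one hx0.ne']
    ring
  have hG := (Real.Gamma_pos_of_pos ha).ne'
  have hra := (Real.rpow_pos_of_pos hr a).ne'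
  rw [h1, h2, h3, integral_const_mul, Real.integral_rpow_mul_exp_neg_mul_Ioi (by linarith) hr,
    Real.Gamma_add_one ha.ne', Real.rpow_add_one (by positivity), Real.div_rpow zero_le_one hr.le,
    Real.one_rpow]
  field_simp

lemma integrable_id_gammaMeasure {a r : ℝ} (ha : 0 < a) (hr : 0 < r) :
    Integrable (fun x => x) (gammaMeasure a r) := by
  by_contra h
  have h2 := integral_id_gammaMeasure ha hr
  rw [integral_undef h] at h2
  exact absurd h2 (by positivity)

lemma ae_pos_gammaMeasure (a r : ℝ) : ∀ᵐ x ∂gammaMeasure a r, 0 < x := by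
  rw [gammaMeasure, ae_withDensity_iff (measurable_gammaPDF a r)]
  filter_upwards [Measure.ae_ne volume (0 : ℝ)] with x hx h
  by_contra hn
  exact h (gammaPDF_of_neg (lt_of_le_of_ne (not_lt.1 hn) hx))

section Data

variable {n m : ℕ} {α γ τ : ℝ}

lemma rate_pos (hα : 0 < α) (γ : ℝ) : 0 < α * Real.exp (-γ) := by positivity

lemma isProbabilityMeasure_incrementLaw (hα : 0 < α) (hτ : 0 < τ) :
    IsProbabilityMeasure (incrementLaw α γ τ) :=
  isProbabilityMeasure_gammaMeasure (by positivity) (rate_pos hα γ)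

lemma dataLaw_const (n m : ℕ) (α γ τ : ℝ) :
    dataLaw n m (fun _ => τ) α γ = Measure.pi fun _ => incrementLaw α γ τ := rfl

/-- All second derivatives of the log-likelihood are almost surely affine in the increments, so only
the mean increment `τ e^γ` enters the information. -/
lemma integral_sum_dataLaw (hα : 0 < α) (hτ : 0 < τ) (c d : ℝ) :
    ∫ z, ∑ i : Fin n, ∑ j : Fin m, (c + d * z (i, j)) ∂dataLaw n m (fun _ => τ) α γ =
      n * m * (c + d * (τ * Real.exp γ)) := by
  have hinc : IsProbabilityMeasure (incrementLaw α γ τ) := isProbabilityMeasure_incrementLaw hα hτ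
  rw [dataLaw_const]
  set μ : Measure (Fin n × Fin m → ℝ) := Measure.pi fun _ => incrementLaw α γ τ with hμ
  have hi (ij : Fin n × Fin m) :
      Integrable (fun z : Fin n × Fin m → ℝ => z ij) μ :=
    integrable_comp_eval (μ := fun _ : Fin n × Fin m => incrementLaw α γ τ) (i := ij)
      (f := fun x : ℝ => x)
      (integrable_id_gammaMeasure (by positivity) (rate_pos hα γ))
  have he (ij : Fin n × Fin m) :
      ∫ z, z ij ∂μ = τ * Real.exp γ := by
    have h := integral_comp_eval (i := ij)
      (μ := fun _ : Fin n × Fin m => incrementLaw α γ τ)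
      (f := fun x : ℝ => x) (by fun_prop)
    refine h.trans ((integral_id_gammaMeasure (by positivity) (rate_pos hα γ)).trans ?_)
    rw [Real.exp_neg]
    field_simp
  have hprob : IsProbabilityMeasure μ := by rw [hμ]; infer_instance
  have hint (ij : Fin n × Fin m) :
      Integrable (fun z : Fin n × Fin m → ℝ => c + d * z ij) μ :=
    (integrable_const c).add ((hi ij).const_mul d)
  rw [integral_finsetSum _ fun i _ => integrable_finsetSum _ fun j _ => hint (i, j)]
  have h1 (i : Fin n) (j : Fin m) : ∫ z, (c + d * z (i, j)) ∂μ =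
      c + d * (τ * Real.exp γ) := by
    rw [integral_add (integrable_const c) ((hi (i, j)).const_mul d), integral_const_mul, he]
    simp
  simp_rw [integral_finsetSum _ fun j _ => hint (_, j), h1]
  simp
  ring

lemma ae_pos_dataLaw (hα : 0 < α) (hτ : 0 < τ) :
    ∀ᵐ z ∂dataLaw n m (fun _ => τ) α γ, ∀ ij, 0 < z ij := by
  have hinc : IsProbabilityMeasure (incrementLaw α γ τ) := isProbabilityMeasure_incrementLaw hα hτ
  rw [dataLaw_const, ae_all_iff]
  intro ij
  exact (measurePreserving_eval
    (fun _ : Fin n × Fin m => incrementLaw α γ τ) ij).quasiMeasurePreserving.ae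
    (ae_pos_gammaMeasure _ _)

lemma log_gammaPDFReal {x : ℝ} (hα : 0 < α) (hτ : 0 < τ) (hx : 0 < x) (γ : ℝ) :
    Real.log (gammaPDFReal (α * τ) (α * Real.exp (-γ)) x) =
      α * τ * (Real.log α - γ) - Real.log (Real.Gamma (α * τ)) + (α * τ - 1) * Real.log x
        - α * Real.exp (-γ) * x := by
  have hG := Real.Gamma_pos_of_pos (mul_pos hα hτ)
  have hr := rate_pos hα γ
  rw [gammaPDFReal, if_pos hx.le, Real.log_mul (by positivity) (by positivity),
    Real.log_mul (by positivity) (by positivity), Real.log_div (by positivity) hG.ne',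
    Real.log_exp, Real.log_rpow hr, Real.log_rpow hx, Real.log_mul hα.ne' (by positivity),
    Real.log_exp]
  ring

variable {z : Fin n × Fin m → ℝ}

lemma partialAlpha_logLikelihood (hα : 0 < α) (hτ : 0 < τ) (hz : ∀ ij, 0 < z ij) (γ : ℝ) :
    partialAlpha (logLikelihood (fun _ => τ) z) α γ =
      ∑ i : Fin n, ∑ j : Fin m, (τ * (Real.log α - γ) + τ - τ * digammaSeries (α * τ)
        + τ * Real.log (z (i, j)) - Real.exp (-γ) * z (i, j)) := by
  refine HasDerivAt.deriv ?_
  refine HasDerivAt.fun_sum fun i _ => HasDerivAt.fun_sum fun j _ => ?_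
  have hm : HasDerivAt (fun a : ℝ => a * τ) τ α := hasDerivAt_mul_const τ
  have h1 := hm.mul ((Real.hasDerivAt_log hα.ne').sub_const γ)
  have h2 : HasDerivAt (fun a => Real.log (Real.Gamma (a * τ))) (digammaSeries (α * τ) * τ) α :=
    HasDerivAt.comp (h₂ := fun y => Real.log (Real.Gamma y)) α
      (hasDerivAt_log_Gamma (mul_pos hα hτ)) hm
  have h3 := (hm.sub_const 1).mul_const (Real.log (z (i, j)))
  have h4 : HasDerivAt (fun a : ℝ => a * Real.exp (-γ) * z (i, j)) (Real.exp (-γ) * z (i, j)) α :=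
    (hasDerivAt_mul_const (Real.exp (-γ))).mul_const _
  refine ((((h1.sub h2).add h3).sub h4).congr_of_eventuallyEq ?_).congr_deriv ?_
  · filter_upwards [Ioi_mem_nhds hα] with a ha
    exact log_gammaPDFReal ha hτ (hz _) γ
  · field_simp

lemma partialGamma_logLikelihood (hα : 0 < α) (hτ : 0 < τ) (hz : ∀ ij, 0 < z ij) (γ : ℝ) :
    partialGamma (logLikelihood (fun _ => τ) z) α γ =
      ∑ i : Fin n, ∑ j : Fin m, (-(α * τ) + α * Real.exp (-γ) * z (i, j)) := by
  refine HasDerivAt.deriv ?_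
  refine HasDerivAt.fun_sum fun i _ => HasDerivAt.fun_sum fun j _ => ?_
  have h1 := ((hasDerivAt_id γ).const_sub (Real.log α)).const_mul (α * τ)
  have h4 := (((hasDerivAt_neg γ).exp).const_mul α).mul_const (z (i, j))
  refine (((((h1.sub_const (Real.log (Real.Gamma (α * τ)))).add_const
    ((α * τ - 1) * Real.log (z (i, j))))).sub h4).congr_of_eventuallyEq ?_).congr_deriv ?_
  · exact Eventually.of_forall fun g => log_gammaPDFReal hα hτ (hz _) g
  · ring

lemma partialAlpha_partialAlpha_logLikelihood (hα : 0 < α) (hτ : 0 < τ) (hz : ∀ ij, 0 < z ij)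
    (γ : ℝ) : partialAlpha (partialAlpha (logLikelihood (fun _ => τ) z)) α γ =
      ∑ _i : Fin n, ∑ _j : Fin m, (τ / α - τ ^ 2 * hurwitzSum 2 (α * τ)) := by
  have h : (fun a => partialAlpha (logLikelihood (fun _ => τ) z) a γ) =ᶠ[𝓝 α] fun a =>
      ∑ i : Fin n, ∑ j : Fin m, (τ * (Real.log a - γ) + τ - τ * digammaSeries (a * τ)
        + τ * Real.log (z (i, j)) - Real.exp (-γ) * z (i, j)) := by
    filter_upwards [Ioi_mem_nhds hα] with a ha using partialAlpha_logLikelihood ha hτ hz γ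
  refine (HasDerivAt.congr_of_eventuallyEq ?_ h).deriv
  refine HasDerivAt.fun_sum fun i _ => HasDerivAt.fun_sum fun j _ => ?_
  have h2 : HasDerivAt (fun a => digammaSeries (a * τ)) (hurwitzSum 2 (α * τ) * τ) α :=
    HasDerivAt.comp (h₂ := digammaSeries) α
      (hasDerivAt_digammaSeries (mul_pos hα hτ)) (hasDerivAt_mul_const τ)
  refine ((((((Real.hasDerivAt_log hα.ne').sub_const γ).const_mul τ).add_const τ).sub
    (h2.const_mul τ)).add_const _ |>.sub_const _).congr_deriv ?_
  field_simp

lemma partialAlpha_partialGamma_logLikelihood (hα : 0 < α) (hτ : 0 < τ) (hz : ∀ ij, 0 < z ij)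
    (γ : ℝ) : partialAlpha (partialGamma (logLikelihood (fun _ => τ) z)) α γ =
      ∑ i : Fin n, ∑ j : Fin m, (-τ + Real.exp (-γ) * z (i, j)) := by
  have h : (fun a => partialGamma (logLikelihood (fun _ => τ) z) a γ) =ᶠ[𝓝 α] fun a =>
      ∑ i : Fin n, ∑ j : Fin m, (-(a * τ) + a * Real.exp (-γ) * z (i, j)) := by
    filter_upwards [Ioi_mem_nhds hα] with a ha using partialGamma_logLikelihood ha hτ hz γ
  refine (HasDerivAt.congr_of_eventuallyEq ?_ h).deriv
  refine HasDerivAt.fun_sum fun i _ => HasDerivAt.fun_sum fun j _ => ?_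
  exact (hasDerivAt_mul_const τ).neg.add
    ((hasDerivAt_mul_const (Real.exp (-γ))).mul_const (z (i, j)))

lemma partialGamma_partialAlpha_logLikelihood (hα : 0 < α) (hτ : 0 < τ) (hz : ∀ ij, 0 < z ij)
    (γ : ℝ) : partialGamma (partialAlpha (logLikelihood (fun _ => τ) z)) α γ =
      ∑ i : Fin n, ∑ j : Fin m, (-τ + Real.exp (-γ) * z (i, j)) := by
  rw [partialGamma]
  simp_rw [partialAlpha_logLikelihood hα hτ hz]
  refine HasDerivAt.deriv ?_
  refine HasDerivAt.fun_sum fun i _ => HasDerivAt.fun_sum fun j _ => ?_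
  refine ((((((hasDerivAt_id γ).const_sub (Real.log α)).const_mul τ).add_const τ).sub_const
    _).add_const _ |>.sub ((hasDerivAt_neg γ).exp.mul_const (z (i, j)))).congr_deriv ?_
  ring

lemma partialGamma_partialGamma_logLikelihood (hα : 0 < α) (hτ : 0 < τ) (hz : ∀ ij, 0 < z ij)
    (γ : ℝ) : partialGamma (partialGamma (logLikelihood (fun _ => τ) z)) α γ =
      ∑ i : Fin n, ∑ j : Fin m, (-(α * Real.exp (-γ)) * z (i, j)) := by
  rw [partialGamma]
  simp_rw [partialGamma_logLikelihood hα hτ hz]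
  refine HasDerivAt.deriv ?_
  refine HasDerivAt.fun_sum fun i _ => HasDerivAt.fun_sum fun j _ => ?_
  refine ((((hasDerivAt_neg γ).exp.const_mul α).mul_const (z (i, j))).const_add _).congr_deriv ?_
  ring

/-- The expectation of minus a function that is almost surely an affine statistic. -/
lemma integral_neg_dataLaw (hα : 0 < α) (hτ : 0 < τ) {f : (Fin n × Fin m → ℝ) → ℝ} {c d : ℝ}
    (hf : ∀ z : Fin n × Fin m → ℝ, (∀ ij, 0 < z ij) →
      f z = ∑ i : Fin n, ∑ j : Fin m, (c + d * z (i, j))) :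
    ∫ z, -f z ∂dataLaw n m (fun _ => τ) α γ = -(n * m * (c + d * (τ * Real.exp γ))) := by
  rw [integral_neg, ← integral_sum_dataLaw hα hτ]
  congr 1
  refine integral_congr_ae ?_
  filter_upwards [ae_pos_dataLaw hα hτ] with z hz using hf z hz

/-- The Fisher information of a periodic design is diagonal. -/
lemma fisherInfo_eq (n m : ℕ) (hα : 0 < α) (hτ : 0 < τ) (γ : ℝ) :
    fisherInfo n m (fun _ => τ) α γ =
      !![n * m * (trigammaExcess (α * τ) / α ^ 2), 0; 0, n * m * (α * τ)] := by
  have hexp : Real.exp (-γ) * Real.exp γ = 1 := by rw [← Real.exp_add]; simp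
  have e1 := integral_neg_dataLaw (n := n) (m := m) (γ := γ)
    (c := τ / α - τ ^ 2 * hurwitzSum 2 (α * τ)) (d := 0) hα hτ fun z hz =>
    (partialAlpha_partialAlpha_logLikelihood hα hτ hz γ).trans (by simp only [zero_mul, add_zero])
  have e2 := integral_neg_dataLaw (n := n) (m := m) (γ := γ) hα hτ fun z hz =>
    partialAlpha_partialGamma_logLikelihood hα hτ hz γ
  have e3 := integral_neg_dataLaw (n := n) (m := m) (γ := γ) hα hτ fun z hz =>
    partialGamma_partialAlpha_logLikelihood hα hτ hz γ
  have e4 := integral_neg_dataLaw (n := n) (m := m) (γ := γ) (c := 0)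
    (d := -(α * Real.exp (-γ))) hα hτ fun z hz =>
    (partialGamma_partialGamma_logLikelihood hα hτ hz γ).trans (by simp only [zero_add])
  rw [fisherInfo, e1, e2, e3, e4, trigammaExcess]
  -- The mean increment `τ e^γ` cancels the drift exactly: this is the orthogonality of `α` and `γ`.
  have o : -(n * m * (-τ + Real.exp (-γ) * (τ * Real.exp γ))) = 0 := by
    linear_combination (-(n * m * τ)) * hexp
  have o' : -(n * m * (0 + -(α * Real.exp (-γ)) * (τ * Real.exp γ))) = n * m * (α * τ) := by
    linear_combination (n * m * τ * α) * hexp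
  rw [o, o']
  congr 3
  field_simp
  ring

end Data

/-! ### The criteria as functions of `α τ` -/

/-- Up to a positive factor, the common form of the two design criteria as functions of `α * τ`. -/
noncomputable def criterion (k x : ℝ) : ℝ := k / x + 1 / trigammaExcess x

lemma inv_diag_two {a b : ℝ} (ha : a ≠ 0) (hb : b ≠ 0) :
    (!![a, 0; 0, b] : Matrix (Fin 2) (Fin 2) ℝ)⁻¹ = !![a⁻¹, 0; 0, b⁻¹] := by
  refine Matrix.inv_eq_right_inv ?_
  ext i j
  fin_cases i <;> fin_cases j <;> simp [Matrix.mul_apply, ha, hb]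

lemma inv_fisherInfo {n m : ℕ} {α τ : ℝ} (hn : 1 ≤ n) (hm : 1 ≤ m) (hα : 0 < α) (hτ : 0 < τ)
    (γ : ℝ) : (fisherInfo n m (fun _ => τ) α γ)⁻¹ =
      !![(n * m * (trigammaExcess (α * τ) / α ^ 2) : ℝ)⁻¹, 0; 0, (n * m * (α * τ) : ℝ)⁻¹] := by
  have hP := trigammaExcess_pos (mul_pos hα hτ)
  rw [fisherInfo_eq n m hα hτ, inv_diag_two] <;> positivity

lemma phiV_eq {n m : ℕ} {α τ : ℝ} (hn : 1 ≤ n) (hm : 1 ≤ m) (hα : 0 < α) (hτ : 0 < τ)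
    (η p γ : ℝ) (h : h₁ η p α γ ≠ 0) :
    phiV η p α γ n m τ = α ^ 2 * h₁ η p α γ ^ 2 / (n * m) *
      criterion (h₂ η p α γ ^ 2 / (α ^ 2 * h₁ η p α γ ^ 2)) (α * τ) := by
  have hP := trigammaExcess_pos (mul_pos hα hτ)
  have hn0 : (0 : ℝ) < n := by exact_mod_cast hn
  have hm0 : (0 : ℝ) < m := by exact_mod_cast hm
  rw [phiV, inv_fisherInfo hn hm hα hτ, criterion]
  simp [dotProduct, Matrix.mulVec, Fin.sum_univ_two]
  field_simp
  ring

lemma phiA_eq {n m : ℕ} {α τ : ℝ} (hn : 1 ≤ n) (hm : 1 ≤ m) (hα : 0 < α) (hτ : 0 < τ) (γ : ℝ) :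
    phiA α γ n m τ = α ^ 2 / (n * m) * criterion (1 / α ^ 2) (α * τ) := by
  have hP := trigammaExcess_pos (mul_pos hα hτ)
  have hn0 : (0 : ℝ) < n := by exact_mod_cast hn
  have hm0 : (0 : ℝ) < m := by exact_mod_cast hm
  rw [phiA, inv_fisherInfo hn hm hα hτ, criterion, Matrix.trace_fin_two]
  simp
  field_simp
  ring

/-- The derivative of `1 / P` is `-P' / P²`, which equals `-Ω / x²` because `N = x² P'`. -/
lemma hasDerivAt_criterion (k : ℝ) {x : ℝ} (hx : 0 < x) :
    HasDerivAt (criterion k) (-(k + Omega x) / x ^ 2) x := by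
  have hP := trigammaExcess_pos hx
  have h1 := (hasDerivAt_inv hx.ne').const_mul k
  have h2 := (hasDerivAt_trigammaExcess hx).inv hP.ne'
  have h3 := h1.add h2
  rw [Omega_eq hx]
  refine (h3.congr_of_eventuallyEq (Eventually.of_forall fun y => ?_)).congr_deriv ?_
  · simp [criterion, div_eq_mul_inv]
  · field_simp
    ring

lemma strictAntiOn_criterion {k : ℝ} (hk : 2 / 3 ≤ k) : StrictAntiOn (criterion k) (Ioi 0) :=
  strictAntiOn_Ioi_of_hasDerivAt_neg (fun _ => hasDerivAt_criterion k) fun x hx => by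
    have := (bijOn_Omega.mapsTo hx).1
    exact div_neg_of_neg_of_pos (by linarith) (by positivity)

section Minimizer

variable {k : ℝ}

lemma OmegaInv_spec (hk0 : 0 < k) (hk : k < 2 / 3) :
    0 < OmegaInv (-k) ∧ Omega (OmegaInv (-k)) = -k := by
  have h : -k ∈ Omega '' Ioi 0 := bijOn_Omega.surjOn ⟨by linarith, by linarith⟩
  exact ⟨Function.invFunOn_mem h, Function.invFunOn_eq h⟩

lemma strictAntiOn_criterion_Ioc (hk0 : 0 < k) (hk : k < 2 / 3) :
    StrictAntiOn (criterion k) (Ioc 0 (OmegaInv (-k))) := by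
  obtain ⟨h0, h1⟩ := OmegaInv_spec hk0 hk
  refine strictAntiOn_of_deriv_neg (convex_Ioc _ _)
    (fun y hy => (hasDerivAt_criterion k hy.1).continuousAt.continuousWithinAt) fun y hy => ?_
  rw [interior_Ioc] at hy
  rw [(hasDerivAt_criterion k hy.1).deriv]
  have := strictAntiOn_Omega hy.1 h0 hy.2
  have hy1 : 0 < y := hy.1
  exact div_neg_of_neg_of_pos (by linarith) (by positivity)

lemma strictMonoOn_criterion_Ici (hk0 : 0 < k) (hk : k < 2 / 3) :
    StrictMonoOn (criterion k) (Ici (OmegaInv (-k))) := by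
  obtain ⟨h0, h1⟩ := OmegaInv_spec hk0 hk
  refine strictMonoOn_of_deriv_pos (convex_Ici _)
    (fun y hy => (hasDerivAt_criterion k (h0.trans_le hy)).continuousAt.continuousWithinAt)
    fun y hy => ?_
  rw [interior_Ici] at hy
  have hy0 : 0 < y := h0.trans hy
  rw [(hasDerivAt_criterion k hy0).deriv]
  have := strictAntiOn_Omega h0 hy0 hy
  exact div_pos (by linarith) (by positivity)

end Minimizer

variable {φ : ℝ → ℝ} {α c k : ℝ}

lemma strictAntiOn_of_eq_criterion (hα : 0 < α) (hc : 0 < c)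
    (hφ : ∀ τ, 0 < τ → φ τ = c * criterion k (α * τ)) (hk : 2 / 3 ≤ k) :
    StrictAntiOn φ (Ioi 0) := by
  intro s hs t ht hst
  rw [hφ s hs, hφ t ht]
  exact mul_lt_mul_of_pos_left (strictAntiOn_criterion hk (mul_pos hα hs) (mul_pos hα ht)
    (mul_lt_mul_of_pos_left hst hα)) hc

lemma isUniqueMinimizerOn_of_eq_criterion (hα : 0 < α) (hc : 0 < c)
    (hφ : ∀ τ, 0 < τ → φ τ = c * criterion k (α * τ)) (hk0 : 0 < k) (hk : k < 2 / 3)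
    {δ : ℝ} (hδ : 0 < δ) :
    IsUniqueMinimizerOn φ (Ici δ) (max δ (OmegaInv (-k) / α)) := by
  refine ⟨mem_Ici.2 (le_max_left _ _), fun τ hτ hne => ?_⟩
  have hτ0 : 0 < τ := hδ.trans_le hτ
  have hM : 0 < max δ (OmegaInv (-k) / α) := hδ.trans_le (le_max_left _ _)
  rw [hφ _ hM, hφ τ hτ0]
  refine mul_lt_mul_of_pos_left ?_ hc
  have hge : OmegaInv (-k) ≤ α * max δ (OmegaInv (-k) / α) := by
    rw [mul_comm, ← div_le_iff₀ hα]
    exact le_max_right _ _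
  rcases lt_or_gt_of_ne hne with h | h
  -- An admissible `τ` below the maximum forces the maximum to be the critical point, so both points
  -- lie on the decreasing branch.
  · have hlt : τ < OmegaInv (-k) / α := by
      rcases lt_max_iff.1 h with h' | h'
      · exact absurd h' (not_lt.2 hτ)
      · exact h'
    have heq : max δ (OmegaInv (-k) / α) = OmegaInv (-k) / α :=
      max_eq_right (le_trans hτ hlt.le)
    rw [heq, mul_div_cancel₀ _ hα.ne']
    have hlt' : α * τ < OmegaInv (-k) := by rwa [mul_comm, ← lt_div_iff₀ hα]
    exact strictAntiOn_criterion_Ioc hk0 hk ⟨mul_pos hα hτ0, hlt'.le⟩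
      ⟨(OmegaInv_spec hk0 hk).1, le_rfl⟩ hlt'
  · have hlt := mul_lt_mul_of_pos_left h hα
    exact strictMonoOn_criterion_Ici hk0 hk hge (hge.trans hlt.le) hlt

/-! ### Sensitivity of the lifetime quantile -/

/-- The upper incomplete gamma function. -/
noncomputable def upperGamma (s c : ℝ) : ℝ := ∫ x in Ioi c, Real.exp (-x) * x ^ (s - 1)

lemma integrableOn_upperGamma {s c : ℝ} (hs : 0 < s) (hc : 0 ≤ c) :
    IntegrableOn (fun x => Real.exp (-x) * x ^ (s - 1)) (Ioi c) :=
  (Real.GammaIntegral_convergent hs).mono_set (Ioi_subset_Ioi hc)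

lemma upperGamma_zero {s : ℝ} (hs : 0 < s) : upperGamma s 0 = Real.Gamma s :=
  (Real.Gamma_eq_integral hs).symm

lemma upperGamma_sub {s c d : ℝ} (hs : 0 < s) (hc : 0 ≤ c) (hcd : c ≤ d) :
    upperGamma s c - upperGamma s d = ∫ x in Ioc c d, Real.exp (-x) * x ^ (s - 1) := by
  have hi := integrableOn_upperGamma hs hc
  rw [upperGamma, upperGamma, ← Ioc_union_Ioi_eq_Ioi hcd, setIntegral_union
    (Ioc_disjoint_Ioi le_rfl) measurableSet_Ioi (hi.mono_set Ioc_subset_Ioi_self)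
    (hi.mono_set (Ioi_subset_Ioi hcd)), add_sub_cancel_right]

/-- Markov's inequality for a gamma variable of shape `s`, whose mean is `s`. It keeps the quantile
away from `0`. -/
lemma upperGamma_le {s c : ℝ} (hs : 0 < s) (hc : 0 < c) :
    upperGamma s c ≤ s / c * Real.Gamma s := by
  have hs1 : 0 < s + 1 := by linarith
  have hle : upperGamma s c ≤ ∫ x in Ioi c, 1 / c * (Real.exp (-x) * x ^ (s + 1 - 1)) := by
    refine setIntegral_mono_on (integrableOn_upperGamma hs hc.le)
      ((integrableOn_upperGamma hs1 hc.le).const_mul _) measurableSet_Ioi fun x hx => ?_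
    have hx0 : 0 < x := hc.trans hx
    rw [show s + 1 - 1 = s - 1 + 1 by ring, Real.rpow_add_one hx0.ne', one_div_mul_eq_div,
      le_div_iff₀ hc, ← mul_assoc]
    have hx' : c ≤ x := le_of_lt hx
    gcongr
  rw [integral_const_mul] at hle
  have h2 : ∫ x in Ioi c, Real.exp (-x) * x ^ (s + 1 - 1) ≤ Real.Gamma (s + 1) := by
    rw [Real.Gamma_eq_integral hs1]
    refine setIntegral_mono_set (Real.GammaIntegral_convergent hs1) ?_
      (Ioi_subset_Ioi hc.le).eventuallyLE
    filter_upwards [ae_restrict_mem measurableSet_Ioi] with x hx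
    have hx0 : (0 : ℝ) < x := hx
    simp only [Pi.zero_apply]
    positivity
  rw [Real.Gamma_add_one hs.ne'] at h2
  calc upperGamma s c ≤ 1 / c * (s * Real.Gamma s) := hle.trans (by gcongr)
    _ = _ := by ring

/-- Markov's inequality for the reciprocal of a gamma variable, whose mean is `1 / (s - 1)`. It
shows that the level `p` is reached. -/
lemma le_upperGamma {s c : ℝ} (hs : 1 < s) (hc : 0 < c) :
    (1 - c / (s - 1)) * Real.Gamma s ≤ upperGamma s c := by
  have hs0 : 0 < s := by linarith
  have hs1 : 0 < s - 1 := by linarith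
  have hsub := upperGamma_sub hs0 le_rfl hc.le
  rw [upperGamma_zero hs0] at hsub
  have hle : ∫ x in Ioc 0 c, Real.exp (-x) * x ^ (s - 1) ≤
      ∫ x in Ioc 0 c, c * (Real.exp (-x) * x ^ (s - 1 - 1)) := by
    refine setIntegral_mono_on
      ((integrableOn_upperGamma hs0 le_rfl).mono_set Ioc_subset_Ioi_self)
      (((integrableOn_upperGamma hs1 le_rfl).mono_set Ioc_subset_Ioi_self).const_mul _)
      measurableSet_Ioc fun x hx => ?_
    have hx0 : 0 < x := hx.1
    have e : x ^ (s - 1) = x * x ^ (s - 1 - 1) := by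
      rw [Real.rpow_sub_one hx0.ne' (s - 1)]
      field_simp
    rw [e, mul_left_comm]
    have hx' : x ≤ c := hx.2
    gcongr
  rw [integral_const_mul] at hle
  have h2 : ∫ x in Ioc 0 c, Real.exp (-x) * x ^ (s - 1 - 1) ≤ Real.Gamma (s - 1) := by
    rw [Real.Gamma_eq_integral hs1]
    refine setIntegral_mono_set (Real.GammaIntegral_convergent hs1) ?_
      (Ioc_subset_Ioi_self).eventuallyLE
    filter_upwards [ae_restrict_mem measurableSet_Ioi] with x hx
    have hx0 : (0 : ℝ) < x := hx
    simp only [Pi.zero_apply]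
    positivity
  have hG : Real.Gamma s = (s - 1) * Real.Gamma (s - 1) := by
    rw [← Real.Gamma_add_one hs1.ne', sub_add_cancel]
  have h3 : c / (s - 1) * Real.Gamma s = c * Real.Gamma (s - 1) := by
    rw [hG]
    field_simp
  have h4 := mul_le_mul_of_nonneg_left h2 hc.le
  linarith

/-- The integrand is convex in `s`. Convexity supplies continuity and local Lipschitz bounds in the
shape without differentiating under the integral. -/
lemma convexOn_upperGamma {c : ℝ} (hc : 0 ≤ c) :
    ConvexOn ℝ (Ioi 0) (fun s => upperGamma s c) := by
  refine ⟨convex_Ioi 0, fun s hs t ht a b ha hb hab => ?_⟩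
  have hst : 0 < a • s + b • t := (convex_Ioi (0 : ℝ)) hs ht ha hb hab
  simp only [upperGamma, smul_eq_mul] at hst ⊢
  rw [← integral_const_mul, ← integral_const_mul,
    ← integral_add ((integrableOn_upperGamma hs hc).const_mul a)
    ((integrableOn_upperGamma ht hc).const_mul b)]
  refine setIntegral_mono_on (integrableOn_upperGamma hst hc)
    (((integrableOn_upperGamma hs hc).const_mul a).add
    ((integrableOn_upperGamma ht hc).const_mul b)) measurableSet_Ioi fun x hx => ?_
  have hx0 : 0 < x := hc.trans_lt hx
  have h := (convexOn_rpow_left hx0).2 (mem_univ (s - 1)) (mem_univ (t - 1)) ha hb hab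
  simp only [smul_eq_mul] at h
  have e : a * (s - 1) + b * (t - 1) = a * s + b * t - 1 := by linear_combination -hab
  rw [e] at h
  calc Real.exp (-x) * x ^ (a * s + b * t - 1)
      ≤ Real.exp (-x) * (a * x ^ (s - 1) + b * x ^ (t - 1)) := by gcongr
    _ = _ := by ring

lemma lifetimeCDF_eq {η α γ t : ℝ} (hη : 0 < η) (hα : 0 < α) (ht : 0 < t) :
    lifetimeCDF η α γ t =
      upperGamma (α * t) (α * Real.exp (-γ) * η) / Real.Gamma (α * t) := by
  set a := α * t with ha'
  set r := α * Real.exp (-γ) with hr'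
  have ha : 0 < a := mul_pos hα ht
  have hr : 0 < r := rate_pos hα γ
  have h1 : (gammaMeasure a r).real (Ici η) = ∫ x in Ici η, gammaPDFReal a r x := by
    rw [measureReal_def, gammaMeasure, withDensity_apply _ measurableSet_Ici,
      integral_eq_lintegral_of_nonneg_ae (ae_of_all _ (gammaPDFReal_nonneg ha hr))
        (measurable_gammaPDFReal a r).aestronglyMeasurable]
    rfl
  have h2 : ∫ x in Ioi η, gammaPDFReal a r x =
      ∫ x in Ioi η, r / Real.Gamma a * (Real.exp (-(r * x)) * (r * x) ^ (a - 1)) := by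
    refine setIntegral_congr_fun measurableSet_Ioi fun x hx => ?_
    have hx0 : 0 < x := hη.trans hx
    simp only [gammaPDFReal, if_pos hx0.le]
    rw [Real.mul_rpow hr.le hx0.le, Real.rpow_sub_one hr.ne']
    field_simp
  have h3 := integral_comp_mul_left_Ioi (fun y => Real.exp (-y) * y ^ (a - 1)) η hr
  rw [lifetimeCDF, incrementLaw, h1, integral_Ici_eq_integral_Ioi, h2, integral_const_mul, h3,
    upperGamma, smul_eq_mul]
  field_simp

/-- The `p`-quantile as a function of the scaled threshold, for unit shape and rate per time. -/
noncomputable def scaledQuantile (p c : ℝ) : ℝ :=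
  sInf {s : ℝ | 0 < s ∧ p ≤ upperGamma s c / Real.Gamma s}

/-- Time enters the distribution function only through the shape `α t`, and the threshold only
through its product with the rate. -/
lemma lifetimeQuantile_eq {η p α γ : ℝ} (hη : 0 < η) (hα : 0 < α) :
    lifetimeQuantile η p α γ = α⁻¹ * scaledQuantile p (α * Real.exp (-γ) * η) := by
  rw [lifetimeQuantile, scaledQuantile, ← smul_eq_mul,
    ← Real.sInf_smul_of_nonneg (inv_pos.2 hα).le]
  congr 1
  ext t
  rw [mem_smul_set_iff_inv_smul_mem₀ (inv_pos.2 hα).ne', inv_inv, smul_eq_mul]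
  simp only [mem_ofPred_eq, mul_pos_iff_of_pos_left hα]
  refine and_congr_right fun ht => ?_
  rw [lifetimeCDF_eq hη hα ht]

lemma continuousOn_survival {c : ℝ} (hc : 0 ≤ c) :
    ContinuousOn (fun s => upperGamma s c / Real.Gamma s) (Ioi 0) :=
  ((convexOn_upperGamma hc).continuousOn isOpen_Ioi).div
    (Real.convexOn_Gamma.continuousOn isOpen_Ioi) fun _ hs => (Real.Gamma_pos_of_pos hs).ne'

lemma scaledQuantile_spec {p c : ℝ} (hp0 : 0 < p) (hp1 : p < 1) (hc : 0 < c) :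
    0 < scaledQuantile p c ∧
      upperGamma (scaledQuantile p c) c = p * Real.Gamma (scaledQuantile p c) := by
  set T := {s : ℝ | 0 < s ∧ p ≤ upperGamma s c / Real.Gamma s} with hT
  have hlow : ∀ s ∈ T, p * c ≤ s := by
    rintro s ⟨hs, hps⟩
    rw [← le_div_iff₀ hc]
    refine hps.trans ?_
    rw [div_le_iff₀ (Real.Gamma_pos_of_pos hs)]
    exact upperGamma_le hs hc
  have hne : T.Nonempty := by
    have hp : 0 < 1 - p := by linarith
    -- The witness solves `1 - c / (s - 1) = p`.
    have hs : 1 < 1 + c / (1 - p) := by have := div_pos hc hp; linarith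
    refine ⟨1 + c / (1 - p), by linarith, ?_⟩
    rw [le_div_iff₀ (Real.Gamma_pos_of_pos (by linarith))]
    have h := le_upperGamma hs hc
    have e : 1 - c / (1 + c / (1 - p) - 1) = p := by
      rw [add_sub_cancel_left, div_div_cancel₀ hc.ne']
      ring
    rwa [e] at h
  have hbdd : BddBelow T := ⟨p * c, hlow⟩
  have hS : scaledQuantile p c = sInf T := rfl
  rw [hS]
  have hpos : 0 < sInf T := (mul_pos hp0 hc).trans_le (le_csInf hne hlow)
  have hcont : ContinuousAt (fun s => upperGamma s c / Real.Gamma s) (sInf T) :=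
    (continuousOn_survival hc.le).continuousAt (Ioi_mem_nhds hpos)
  refine ⟨hpos, ?_⟩
  rw [← div_eq_iff (Real.Gamma_pos_of_pos hpos).ne']
  -- No monotonicity in the shape is needed: a value above `p` would, by continuity, put smaller
  -- points into the set, and a sequence in the set tending to the infimum gives the other
  -- inequality.
  refine le_antisymm ?_ ?_
  · by_contra! h
    obtain ⟨s, ⟨hs, hs0⟩, hlt⟩ := (((hcont.eventually (lt_mem_nhds h)).and
      (Ioi_mem_nhds hpos)).filter_mono nhdsWithin_le_nhds |>.and
      (self_mem_nhdsWithin (s := Iio (sInf T)))).exists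
    exact (not_lt.2 (csInf_le hbdd ⟨hs0, hs.le⟩)) hlt
  · obtain ⟨u, -, hu, huT⟩ := exists_seq_tendsto_sInf hne hbdd
    exact ge_of_tendsto' (hcont.tendsto.comp hu) fun k => (huT k).2

/-- The density of the gamma distribution is bounded below near a positive point, uniformly for
bounded shapes. -/
lemma exists_le_density {c b : ℝ} (hc : 0 < c) :
    ∃ κ > 0, ∀ s ∈ Ioo 0 b, ∀ x ∈ Ioc c (c + 1), κ ≤ Real.exp (-x) * x ^ (s - 1) := by
  -- `M` bounds `|log x|` on the interval and `b + 1` bounds `|s - 1|`, which bounds the exponent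
  -- `-x + (s - 1) log x` from below.
  set M := |Real.log c| + |Real.log (c + 1)|
  refine ⟨Real.exp (-(c + 1) - (b + 1) * M), Real.exp_pos _, fun s hs x hx => ?_⟩
  have hx0 : 0 < x := hc.trans hx.1
  rw [Real.rpow_def_of_pos hx0, ← Real.exp_add, Real.exp_le_exp]
  have h1 : |Real.log x| ≤ M := by
    have hl := Real.log_le_log hc hx.1.le
    have hu := Real.log_le_log hx0 hx.2
    rw [abs_le]
    constructor
    · linarith [neg_abs_le (Real.log c), abs_nonneg (Real.log (c + 1))]
    · linarith [le_abs_self (Real.log (c + 1)), abs_nonneg (Real.log c)]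
  have h2 : |s - 1| ≤ b + 1 := by
    rw [abs_le]
    constructor <;> linarith [hs.1, hs.2]
  have h3 : |Real.log x * (s - 1)| ≤ (b + 1) * M := by
    rw [abs_mul, mul_comm]
    exact mul_le_mul h2 h1 (abs_nonneg _) ((abs_nonneg _).trans h2)
  linarith [neg_abs_le (Real.log x * (s - 1)), hx.2]

lemma exists_lipschitz_bound {p c s₀ : ℝ} (hc : 0 ≤ c) (hs₀ : 0 < s₀) :
    ∃ L : ℝ, 0 ≤ L ∧ ∀ᶠ s in 𝓝 s₀, |(upperGamma s c - p * Real.Gamma s) -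
      (upperGamma s₀ c - p * Real.Gamma s₀)| ≤ L * |s - s₀| := by
  obtain ⟨K₁, t₁, ht₁, h₁⟩ := (convexOn_upperGamma hc).locallyLipschitzOn isOpen_Ioi hs₀
  obtain ⟨K₂, t₂, ht₂, h₂⟩ := Real.convexOn_Gamma.locallyLipschitzOn isOpen_Ioi hs₀
  rw [isOpen_Ioi.nhdsWithin_eq hs₀] at ht₁ ht₂
  refine ⟨K₁ + |p| * K₂, by positivity, ?_⟩
  filter_upwards [ht₁, ht₂] with s hs1 hs2
  have e1 := h₁.dist_le_mul s hs1 s₀ (mem_of_mem_nhds ht₁)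
  have e2 := h₂.dist_le_mul s hs2 s₀ (mem_of_mem_nhds ht₂)
  rw [Real.dist_eq, Real.dist_eq] at e1 e2
  calc |(upperGamma s c - p * Real.Gamma s) - (upperGamma s₀ c - p * Real.Gamma s₀)|
      = |(upperGamma s c - upperGamma s₀ c) - p * (Real.Gamma s - Real.Gamma s₀)| := by ring_nf
    _ ≤ |upperGamma s c - upperGamma s₀ c| + |p * (Real.Gamma s - Real.Gamma s₀)| := abs_sub _ _
    _ ≤ K₁ * |s - s₀| + |p| * (K₂ * |s - s₀|) := by
      rw [abs_mul]
      gcongr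
    _ = _ := by ring

/-- The scaled quantile has no stationary point in the scaled threshold. -/
lemma not_hasDerivAt_scaledQuantile_zero {p c : ℝ} (hp0 : 0 < p) (hp1 : p < 1) (hc : 0 < c) :
    ¬ HasDerivAt (scaledQuantile p) 0 c := by
  intro hd
  obtain ⟨hs₀, heq₀⟩ := scaledQuantile_spec hp0 hp1 hc
  set s₀ := scaledQuantile p c with hs₀def
  obtain ⟨L, hL, hlip⟩ := exists_lipschitz_bound (p := p) hc.le hs₀
  obtain ⟨κ, hκ, hdens⟩ := exists_le_density (b := s₀ + 1) hc
  -- The constant is chosen so that its product with the Lipschitz constant `L` is less than `κ`.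
  have hlittle := (hasDerivAt_iff_isLittleO.1 hd).def
    (show 0 < κ / (2 * (L + 1)) by positivity)
  have hcont := hd.continuousAt.tendsto
  obtain ⟨d, ⟨⟨⟨hd1, hd2⟩, hd3⟩, hd4⟩⟩ := ((((hlittle.and (hcont.eventually hlip)).and
    (hcont.eventually (gt_mem_nhds (show s₀ < s₀ + 1 by linarith)))).filter_mono
    nhdsWithin_le_nhds).and (Ioo_mem_nhdsGT (show c < c + 1 by linarith))).exists
  have hd0 : 0 < d := hc.trans hd4.1
  obtain ⟨hs, heq⟩ := scaledQuantile_spec hp0 hp1 hd0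
  set s := scaledQuantile p d
  -- The difference `upperGamma s c - p Γ(s)` is estimated twice. By the quantile equation at `d` it
  -- is the integral over `(c, d]`, hence at least `κ (d - c)`; by the Lipschitz bound it is at most
  -- `L |s - s₀|`, too small if the derivative vanishes.
  have hsub := upperGamma_sub hs hc.le hd4.1.le
  have hint : κ * (d - c) ≤ ∫ x in Ioc c d, Real.exp (-x) * x ^ (s - 1) := by
    have h := setIntegral_ge_of_const_le_real (μ := volume) (c := κ) measurableSet_Ioc (by simp)
      (fun x (hx : x ∈ Ioc c d) => hdens s ⟨hs, hd3⟩ x ⟨hx.1, hx.2.trans hd4.2.le⟩)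
      ((integrableOn_upperGamma hs hc.le).mono_set Ioc_subset_Ioi_self)
    rwa [Real.volume_real_Ioc_of_le hd4.1.le] at h
  have hdc : 0 < d - c := sub_pos.2 hd4.1
  rw [smul_zero, sub_zero, Real.norm_eq_abs, Real.norm_eq_abs, abs_of_pos hdc] at hd1
  rw [← heq, heq₀, sub_self, sub_zero, hsub] at hd2
  have h1 : κ * (d - c) ≤ L * (κ / (2 * (L + 1)) * (d - c)) :=
    hint.trans ((le_abs_self _).trans (hd2.trans (by gcongr)))
  have h2 : L * (κ / (2 * (L + 1)) * (d - c)) = κ * (d - c) * (L / (2 * (L + 1))) := by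
    field_simp
  have h3 : L / (2 * (L + 1)) < 1 := by
    rw [div_lt_one (by positivity)]
    linarith
  have h4 := mul_lt_mul_of_pos_left h3 (mul_pos hκ hdc)
  linarith

/-- If the quantile is sensitive to `α`, then it is also sensitive to `γ`. -/
lemma h₂_ne_zero {η p α γ : ℝ} (hη : 0 < η) (hp0 : 0 < p) (hp1 : p < 1) (hα : 0 < α)
    (h : h₁ η p α γ ≠ 0) : h₂ η p α γ ≠ 0 := by
  set b := Real.exp (-γ) * η with hb
  have hb0 : 0 < b := by positivity
  have hc0 : 0 < α * b := mul_pos hα hb0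
  -- `deriv` takes the value `0` at points of non-differentiability, so `h₁ ≠ 0` already contains
  -- differentiability in `α`.
  have hdiff : DifferentiableAt ℝ (fun a => lifetimeQuantile η p a γ) α :=
    differentiableAt_of_deriv_ne_zero h
  -- Near `α b` the scaled quantile is recovered from the lifetime quantile by the substitution `a =
  -- c / b`.
  have hS : DifferentiableAt ℝ (scaledQuantile p) (α * b) := by
    have h1 : DifferentiableAt ℝ (fun a => a * lifetimeQuantile η p a γ) (α * b / b) := by
      rw [mul_div_cancel_right₀ _ hb0.ne']
      exact differentiableAt_id.mul hdiff
    have h2 : DifferentiableAt ℝ (fun c => c / b * lifetimeQuantile η p (c / b) γ) (α * b) :=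
      DifferentiableAt.comp (g := fun a => a * lifetimeQuantile η p a γ) (f := fun c => c / b)
        (α * b) h1 (by fun_prop)
    refine h2.congr_of_eventuallyEq ?_
    filter_upwards [Ioi_mem_nhds hc0] with c hc
    have hcb : 0 < c / b := div_pos hc hb0
    rw [lifetimeQuantile_eq hη hcb, mul_inv_cancel_left₀ hcb.ne', mul_assoc, ← hb,
      div_mul_cancel₀ _ hb0.ne']
  have hinner : HasDerivAt (fun g => α * (Real.exp (-g) * η)) (-(α * b)) γ :=
    ((((hasDerivAt_neg γ).exp).mul_const η).const_mul α).congr_deriv (by rw [hb]; ring)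
  have hcomp : HasDerivAt (fun g => scaledQuantile p (α * (Real.exp (-g) * η)))
      (deriv (scaledQuantile p) (α * b) * -(α * b)) γ :=
    HasDerivAt.comp (h₂ := scaledQuantile p) γ hS.hasDerivAt hinner
  have hq : h₂ η p α γ = α⁻¹ * (deriv (scaledQuantile p) (α * b) * -(α * b)) := by
    rw [h₂, partialGamma]
    simp_rw [lifetimeQuantile_eq hη hα, mul_assoc]
    exact (hcomp.const_mul α⁻¹).deriv
  rw [hq]
  refine mul_ne_zero (inv_ne_zero hα.ne') (mul_ne_zero (fun h0 => ?_) (neg_ne_zero.2 hc0.ne'))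
  have := hS.hasDerivAt
  rw [h0] at this
  exact not_hasDerivAt_scaledQuantile_zero hp0 hp1 hc0 this

end GammaDegradation

theorem theorem2 (α γ η p Δt : ℝ) (n m : ℕ)
    (hα : 0 < α) (hη : 0 < η) (hp0 : 0 < p) (hp1 : p < 1) (hΔt : 0 < Δt)
    (hn : 1 ≤ n) (hm : 1 ≤ m) :
    -- `Ω` is a bijection from `(0, ∞)` onto `(-2/3, 0)`, so that `Ω⁻¹` makes sense
    Set.BijOn GammaDegradation.Omega (Set.Ioi 0) (Set.Ioo (-2 / 3) 0) ∧
    -- V-optimality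
    (∀ h₁ h₂ : ℝ, h₁ = GammaDegradation.h₁ η p α γ → h₂ = GammaDegradation.h₂ η p α γ → h₁ ≠ 0 →
      (2 / 3 ≤ h₂ ^ 2 / (α ^ 2 * h₁ ^ 2) →
        StrictAntiOn (GammaDegradation.phiV η p α γ n m) (Set.Ioi 0)) ∧
      (h₂ ^ 2 / (α ^ 2 * h₁ ^ 2) < 2 / 3 →
        -h₂ ^ 2 / (α ^ 2 * h₁ ^ 2) ∈ Set.Ioo (-2 / 3 : ℝ) 0 ∧
        GammaDegradation.IsUniqueMinimizerOn (GammaDegradation.phiV η p α γ n m) (Set.Ici Δt)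
          (max Δt (GammaDegradation.OmegaInv (-h₂ ^ 2 / (α ^ 2 * h₁ ^ 2)) / α)))) ∧
    -- A-optimality: the same with `h₁ ^ 2 = h₂ ^ 2`
    ((2 / 3 ≤ 1 / α ^ 2 →
        StrictAntiOn (GammaDegradation.phiA α γ n m) (Set.Ioi 0)) ∧
      (1 / α ^ 2 < 2 / 3 →
        GammaDegradation.IsUniqueMinimizerOn (GammaDegradation.phiA α γ n m) (Set.Ici Δt)
          (max Δt (GammaDegradation.OmegaInv (-1 / α ^ 2) / α)))) := by
  have hn0 : (0 : ℝ) < n := by exact_mod_cast hn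
  have hm0 : (0 : ℝ) < m := by exact_mod_cast hm
  refine ⟨GammaDegradation.bijOn_Omega, ?_, ?_⟩
  · rintro h₁ h₂ rfl rfl h
    have hc : 0 < α ^ 2 * GammaDegradation.h₁ η p α γ ^ 2 / (n * m) := by positivity
    have hφ := fun τ hτ => GammaDegradation.phiV_eq (τ := τ) hn hm hα hτ η p γ h
    refine ⟨GammaDegradation.strictAntiOn_of_eq_criterion hα hc hφ, fun hk => ?_⟩
    -- This makes `k` positive, so that `-k` lies in the range of `Ω`.
    have h2 := GammaDegradation.h₂_ne_zero hη hp0 hp1 hα h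
    have hk0 : 0 < GammaDegradation.h₂ η p α γ ^ 2 / (α ^ 2 * GammaDegradation.h₁ η p α γ ^ 2) := by
      positivity
    rw [neg_div (α ^ 2 * GammaDegradation.h₁ η p α γ ^ 2)]
    exact ⟨⟨by linarith, by linarith⟩,
      GammaDegradation.isUniqueMinimizerOn_of_eq_criterion hα hc hφ hk0 hk hΔt⟩
  · have hc : 0 < α ^ 2 / (n * m) := by positivity
    have hφ := fun τ hτ => GammaDegradation.phiA_eq (τ := τ) hn hm hα hτ γ
    refine ⟨GammaDegradation.strictAntiOn_of_eq_criterion hα hc hφ, fun hk => ?_⟩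
    rw [neg_div]
    exact GammaDegradation.isUniqueMinimizerOn_of_eq_criterion hα hc hφ (by positivity) hk hΔt
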